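/- **Definitions.** Let $\mathcal E$ be a category. A *nested sequence* in $\mathcal E$ is a functor $\omega\to\mathcal E$ (with $\omega$ the ordered set of natural numbers) sending every morphism to a monic. Call $\mathcal E$ *suitable* if - (C1) $\mathcal E$ has all finite limits; - (C2) $\mathcal E$ has finite coproducts; these have monic coprojections and are stable under pullback, and for all objects $A,B$ the square $0\to A\to A+B$, $0\to B\to A+B$ is a pullback; - (C3) $\mathcal E$ has colimits of nested sequences; these commute with pullbacks and have monic coprojections. A monad $T=(T,\eta,\mu)$ on $\mathcal E$ is *suitable* if - (M1) $T$ preserves pullbacks and all naturality squares of $\eta$ and $\mu$ are pullbacks; - (M2) $T$ preserves colimits of nested sequences. The pair $(\mathcal E,T)$ is *suitable* if $T$ is a suitable monad on a suitable category $\mathcal E$. Let $(\mathcal E,T)$ be suitable and let $S\in\mathcal E$. A *$T$-graph on $S$* is a span $TS\xleftarrow{\mathrm{dom}}X_1\xrightarrow{\mathrm{cod}}S$ in $\mathcal E$; a map of $T$-graphs on $S$ is a map $X_1\to Y_1$ commuting with $\mathrm{dom}$ and $\mathrm{cod}$. These form a category $\mathcal E'_S$. The composite $X\circ Y$ of two $T$-graphs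 on $S$ has object of arrows $X_1\times_{TS}TY_1$ (the pullback of $\mathrm{dom}\colon X_1\to TS$ and $T\mathrm{cod}\colon TY_1\to TS$), with domain map $X_1\times_{TS}TY_1\to TY_1\xrightarrow{T\mathrm{dom}}T^2S\xrightarrow{\mu_S}TS$ and codomain map $X_1\times_{TS}TY_1\to X_1\xrightarrow{\mathrm{cod}}S$; the identity $T$-graph is $TS\xleftarrow{\eta_S}S\xrightarrow{1}S$. A *$T$-multicategory on $S$* is a $T$-graph $C$ on $S$ with maps $\mathrm{comp}\colon C\circ C\to C$ and $\mathrm{ids}\colon 1\to C$ of $T$-graphs on $S$ (where $1$ is the identity $T$-graph) satisfying the associativity and identity laws, i.e. a monad on the object $S$ in the bicategory of $T$-spans. With the maps of $T$-graphs on $S$ that preserve $\mathrm{comp}$ and $\mathrm{ids}$, these form a category $T\text{-}\mathbf{Multicat}_S$. **Theorem.** Let $(\mathcal E,T)$ be suitable and let $S\in\mathcal E$. Then the forgetful functor $$T\text{-}\mathbf{Multicat}_S\longrightarrow\mathcal E'_S$$ has a left adjoint, the adjunction is monadic (the comparison functor from $T\text{-}\mathbf{Multicat}_S$ to the category of algebras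 of the induced monad is an equivalence), and if $T'_S$ is the resulting monad on $\mathcal E'_S$ then $(\mathcal E'_S,T'_S)$ is suitable. -/

import Mathlib

open CategoryTheory CategoryTheory.Limits

universe v u

namespace Leinster

/-! ### Nested sequences and suitability -/

section Suitable

variable {E : Type u} [Category.{v} E]

/-- A nested sequence in `E`: a functor `ω ⥤ E` which sends every morphism of `ω` to a mono. -/
def IsNested (A : ℕ ⥤ E) : Prop :=
  ∀ ⦃m n : ℕ⦄ (f : m ⟶ n), Mono (A.map f)

variable (E) in
/-- Suitable categories. -/
class SuitableCategory : Prop where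
  hasFiniteLimits : HasFiniteLimits E
  hasFiniteCoproducts : HasFiniteCoproducts E
  /-- finite coproducts have monic coprojections -/
  mono_coproj : ∀ {I : Type} [Finite I] (D : Discrete I ⥤ E) (c : Cocone D), IsColimit c →
    ∀ i, Mono (c.ι.app i)
  /-- for all `A`, `B` the square formed by `0`, `A`, `B`, `A + B` is a pullback -/
  disjoint : ∀ A B : E,
    IsPullback (initial.to A) (initial.to B) (coprod.inl : A ⟶ A ⨿ B) (coprod.inr : B ⟶ A ⨿ B)
  /-- finite coproducts are stable under pullback -/
  stable : ∀ {I : Type} [Finite I] (D : Discrete I ⥤ E) (c : Cocone D), IsColimit c →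
    IsUniversalColimit c
  /-- `E` has colimits of nested sequences -/
  hasColimit_nested : ∀ A : ℕ ⥤ E, IsNested A → HasColimit A
  /-- colimits of nested sequences commute with pullbacks -/
  nested_pullback : ∀ {P A B C : ℕ ⥤ E} {p : P ⟶ A} {q : P ⟶ B} {f : A ⟶ C} {g : B ⟶ C},
    IsNested A → IsNested B → IsNested C → IsPullback p q f g →
    ∀ {cP : Cocone P} {cA : Cocone A} {cB : Cocone B} {cC : Cocone C}
      (hP : IsColimit cP) (hA : IsColimit cA) (hB : IsColimit cB) (_ : IsColimit cC),
      IsPullback (hP.map cA p) (hP.map cB q) (hA.map cC f) (hB.map cC g)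
  /-- colimits of nested sequences have monic coprojections -/
  nested_mono_coproj : ∀ (A : ℕ ⥤ E), IsNested A → ∀ (c : Cocone A), IsColimit c →
    ∀ n, Mono (c.ι.app n)

attribute [instance] SuitableCategory.hasFiniteLimits SuitableCategory.hasFiniteCoproducts

/-- Cartesian monads: the functor part preserves pullbacks, and all naturality squares of the
unit and of the multiplication are pullbacks. -/
structure IsCartesianMonad (T : Monad E) : Prop where
  preserves_pullbacks : PreservesLimitsOfShape WalkingCospan T.toFunctor
  unit_isPullback : ∀ {X Y : E} (f : X ⟶ Y),
    IsPullback (T.η.app X) f (T.map f) (T.η.app Y)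
  mul_isPullback : ∀ {X Y : E} (f : X ⟶ Y),
    IsPullback (T.μ.app X) (T.map (T.map f)) (T.map f) (T.μ.app Y)

/-- Suitable monads: cartesian monads that preserve colimits of nested sequences. -/
structure IsSuitableMonad (T : Monad E) : Prop extends IsCartesianMonad T where
  preserves_nested : ∀ A : ℕ ⥤ E, IsNested A → PreservesColimit A T.toFunctor

end Suitable

/-! ### `T`-graphs on a fixed object -/

variable {E : Type u} [Category.{v} E]

/-- A `T`-graph on `S`: a span `T S ⟵ X₁ ⟶ S`. -/
structure TGraph (T : Monad E) (S : E) where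
  /-- the object of arrows -/
  arr : E
  dom : arr ⟶ T.obj S
  cod : arr ⟶ S

namespace TGraph

variable {T : Monad E} {S : E}

/-- Maps of `T`-graphs on `S`: maps of spans which are the identity on `S`. -/
@[ext]
structure Hom (X Y : TGraph T S) where
  hom : X.arr ⟶ Y.arr
  hom_dom : hom ≫ Y.dom = X.dom
  hom_cod : hom ≫ Y.cod = X.cod

instance : Category (TGraph T S) where
  Hom := Hom
  id X := ⟨𝟙 X.arr, Category.id_comp _, Category.id_comp _⟩
  comp f g := ⟨f.hom ≫ g.hom, by rw [Category.assoc, g.hom_dom, f.hom_dom],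
    by rw [Category.assoc, g.hom_cod, f.hom_cod]⟩
  id_comp f := Hom.ext (Category.id_comp f.hom)
  comp_id f := Hom.ext (Category.comp_id f.hom)
  assoc f g h := Hom.ext (Category.assoc f.hom g.hom h.hom)

theorem comp_hom {X Y Z : TGraph T S} (f : X ⟶ Y) (g : Y ⟶ Z) :
    (f ≫ g).hom = f.hom ≫ g.hom := rfl

theorem rightUnit_aux (X : TGraph T S) : 𝟙 X.arr ≫ X.dom = X.dom ≫ T.map (𝟙 S) := by
  rw [T.map_id, Category.id_comp, Category.comp_id]

variable (T S) in
/-- The identity span on `S`, namely `T S ⟵ S ⟶ S` given by the unit of `T` and the identity. -/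
abbrev unit : TGraph T S where
  arr := S
  dom := T.η.app S
  cod := 𝟙 S

variable [HasPullbacks E]

/-- The composite `X ∘ Y` of spans: its object of arrows is the pullback of
`X₁ ⟶ T S ⟵ T Y₁`, its domain map is `X₁ ×[T S] T Y₁ ⟶ T Y₁ ⟶ T (T S) ⟶ T S`, and its
codomain map is `X₁ ×[T S] T Y₁ ⟶ X₁ ⟶ S`. -/
noncomputable def tensor (X Y : TGraph T S) : TGraph T S where
  arr := pullback X.dom (T.map Y.cod)
  dom := pullback.snd X.dom (T.map Y.cod) ≫ T.map Y.dom ≫ T.μ.app S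
  cod := pullback.fst X.dom (T.map Y.cod) ≫ X.cod

/-- The first projection `X₁ ×[T S] T Y₁ ⟶ X₁`. -/
noncomputable def fst (X Y : TGraph T S) : (tensor X Y).arr ⟶ X.arr :=
  pullback.fst X.dom (T.map Y.cod)

/-- The second projection `X₁ ×[T S] T Y₁ ⟶ T Y₁`. -/
noncomputable def snd (X Y : TGraph T S) : (tensor X Y).arr ⟶ T.obj Y.arr :=
  pullback.snd X.dom (T.map Y.cod)

theorem tensor_dom (X Y : TGraph T S) :
    (tensor X Y).dom = snd X Y ≫ T.map Y.dom ≫ T.μ.app S := rfl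

theorem tensor_cod (X Y : TGraph T S) : (tensor X Y).cod = fst X Y ≫ X.cod := rfl

theorem condition (X Y : TGraph T S) : fst X Y ≫ X.dom = snd X Y ≫ T.map Y.cod :=
  pullback.condition

/-- The map `W ⟶ X₁ ×[T S] T Y₁` with given components. -/
noncomputable def lift {X Y : TGraph T S} {W : E} (a : W ⟶ X.arr) (b : W ⟶ T.obj Y.arr)
    (h : a ≫ X.dom = b ≫ T.map Y.cod) : W ⟶ (tensor X Y).arr :=
  pullback.lift a b h

theorem lift_fst {X Y : TGraph T S} {W : E} (a : W ⟶ X.arr) (b : W ⟶ T.obj Y.arr)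
    (h : a ≫ X.dom = b ≫ T.map Y.cod) : lift a b h ≫ fst X Y = a :=
  pullback.lift_fst a b h

theorem lift_snd {X Y : TGraph T S} {W : E} (a : W ⟶ X.arr) (b : W ⟶ T.obj Y.arr)
    (h : a ≫ X.dom = b ≫ T.map Y.cod) : lift a b h ≫ snd X Y = b :=
  pullback.lift_snd a b h

theorem tensor_hom_ext {X Y : TGraph T S} {W : E} {a b : W ⟶ (tensor X Y).arr}
    (h₁ : a ≫ fst X Y = b ≫ fst X Y) (h₂ : a ≫ snd X Y = b ≫ snd X Y) : a = b :=
  pullback.hom_ext h₁ h₂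

/-- Horizontal composite of maps of spans: `f ∘ g : X ∘ Y ⟶ X' ∘ Y'`. -/
noncomputable def tensorMap {X X' Y Y' : TGraph T S} (f : X ⟶ X') (g : Y ⟶ Y') :
    tensor X Y ⟶ tensor X' Y' where
  hom := lift (fst X Y ≫ f.hom) (snd X Y ≫ T.map g.hom) (by
    rw [Category.assoc, Category.assoc, ← T.map_comp, f.hom_dom, g.hom_cod, condition])
  hom_dom := by
    rw [tensor_dom, ← Category.assoc, lift_snd, Category.assoc, ← T.map_comp_assoc, g.hom_dom,
      tensor_dom]
  hom_cod := by
    rw [tensor_cod, ← Category.assoc, lift_fst, Category.assoc, f.hom_cod, tensor_cod]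

theorem tensorMap_id (X Y : TGraph T S) : tensorMap (𝟙 X) (𝟙 Y) = 𝟙 (tensor X Y) := by
  refine Hom.ext (tensor_hom_ext ?_ ?_)
  · refine (lift_fst _ _ _).trans ((Category.comp_id _).trans (Category.id_comp _).symm)
  · refine (lift_snd _ _ _).trans (Eq.trans ?_ (Category.id_comp _).symm)
    exact (congrArg (snd X Y ≫ ·) (T.map_id Y.arr)).trans (Category.comp_id _)

theorem tensorMap_comp {X X' X'' Y Y' Y'' : TGraph T S} (f : X ⟶ X') (f' : X' ⟶ X'')
    (g : Y ⟶ Y') (g' : Y' ⟶ Y'') :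
    tensorMap (f ≫ f') (g ≫ g') = tensorMap f g ≫ tensorMap f' g' := by
  refine Hom.ext (tensor_hom_ext ?_ ?_)
  · simp only [tensorMap, comp_hom, Category.assoc, lift_fst]
    rw [← Category.assoc (lift _ _ _), lift_fst, Category.assoc]
  · simp only [tensorMap, comp_hom, Category.assoc, lift_snd, T.map_comp]
    rw [← Category.assoc (lift _ _ _), lift_snd, Category.assoc]

/-- The unit coherence map `X ⟶ 1 ∘ X` (invertible for cartesian `T`). -/
noncomputable def leftUnit (X : TGraph T S) : X ⟶ tensor (unit T S) X where
  hom := lift (X := unit T S) X.cod (T.η.app X.arr) (T.η.naturality X.cod)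
  hom_dom := by
    refine (Category.assoc _ _ _).symm.trans ((congrArg (· ≫ _)
      (lift_snd (X := unit T S) X.cod (T.η.app X.arr) (T.η.naturality X.cod))).trans ?_)
    rw [← T.unit_naturality_assoc, T.left_unit]
    exact Category.comp_id _
  hom_cod := (Category.assoc _ _ _).symm.trans ((congrArg (· ≫ _)
    (lift_fst (X := unit T S) X.cod (T.η.app X.arr) (T.η.naturality X.cod))).trans
      (Category.comp_id _))

/-- The unit coherence map `X ⟶ X ∘ 1` (always invertible). -/
noncomputable def rightUnit (X : TGraph T S) : X ⟶ tensor X (unit T S) where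
  hom := lift (Y := unit T S) (𝟙 X.arr) X.dom (rightUnit_aux X)
  hom_dom := (Category.assoc _ _ _).symm.trans ((congrArg (· ≫ _)
    (lift_snd (Y := unit T S) (𝟙 X.arr) X.dom (rightUnit_aux X))).trans
      ((congrArg (X.dom ≫ ·) (T.right_unit S)).trans (Category.comp_id _)))
  hom_cod := (Category.assoc _ _ _).symm.trans ((congrArg (· ≫ _)
    (lift_fst (Y := unit T S) (𝟙 X.arr) X.dom (rightUnit_aux X))).trans (Category.id_comp _))

/-- The associativity coherence map `X ∘ (Y ∘ Z) ⟶ (X ∘ Y) ∘ Z` (invertible for cartesian `T`);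
its components are the evident projections to `X₁` and `T Y₁`, and the projection to `T (T Z₁)`
followed by the multiplication of `T`. -/
noncomputable def assoc (X Y Z : TGraph T S) :
    tensor X (tensor Y Z) ⟶ tensor (tensor X Y) Z where
  hom := lift (X := tensor X Y)
    (lift (fst X (tensor Y Z)) (snd X (tensor Y Z) ≫ T.map (fst Y Z)) (by
      rw [Category.assoc, ← T.map_comp, condition, tensor_cod]))
    (snd X (tensor Y Z) ≫ T.map (snd Y Z) ≫ T.μ.app Z.arr) (by
      rw [tensor_dom, ← Category.assoc, lift_snd, Category.assoc, ← T.map_comp_assoc, condition,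
        Category.assoc, Category.assoc, ← T.mu_naturality, T.map_comp_assoc])
  hom_dom := by
    rw [tensor_dom (tensor X Y) Z, ← Category.assoc, lift_snd, tensor_dom X, tensor_dom Y]
    simp only [Category.assoc, T.map_comp]
    rw [← T.mu_naturality_assoc, T.assoc]
  hom_cod := by
    rw [tensor_cod (tensor X Y) Z, ← Category.assoc, lift_fst, tensor_cod X Y, ← Category.assoc,
      lift_fst, tensor_cod X]

end TGraph

/-! ### `T`-multicategories on a fixed object -/

open TGraph

variable [HasPullbacks E]

/-- A `T`-multicategory on `S`: a monad on the object `S` in the bicategory of `T`-spans, that is,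
a `T`-graph `C` on `S` with maps `comp : C ∘ C ⟶ C` and `ids : 1 ⟶ C` of `T`-graphs on `S`
satisfying the associativity and identity laws. -/
structure TMulticategory (T : Monad E) (S : E) where
  /-- the underlying `T`-graph -/
  graph : TGraph T S
  comp : tensor graph graph ⟶ graph
  ids : unit T S ⟶ graph
  assoc' : tensorMap (𝟙 graph) comp ≫ comp =
    TGraph.assoc graph graph graph ≫ tensorMap comp (𝟙 graph) ≫ comp
  ids_comp : leftUnit graph ≫ tensorMap ids (𝟙 graph) ≫ comp = 𝟙 graph
  comp_ids : rightUnit graph ≫ tensorMap (𝟙 graph) ids ≫ comp = 𝟙 graph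

namespace TMulticategory

variable {T : Monad E} {S : E}

/-- Maps of `T`-multicategories on `S` which are the identity on `S`: maps of the underlying
`T`-graphs on `S` which preserve composition and identities. -/
@[ext]
structure Hom (C D : TMulticategory T S) where
  graphHom : C.graph ⟶ D.graph
  map_comp : C.comp ≫ graphHom = tensorMap graphHom graphHom ≫ D.comp
  map_ids : C.ids ≫ graphHom = D.ids

instance : Category (TMulticategory T S) where
  Hom := Hom
  id C := ⟨𝟙 C.graph, by rw [tensorMap_id, Category.id_comp, Category.comp_id],
    Category.comp_id C.ids⟩
  comp f g := ⟨f.graphHom ≫ g.graphHom,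
    by rw [← Category.assoc, f.map_comp, Category.assoc, g.map_comp, tensorMap_comp,
      Category.assoc],
    by rw [← Category.assoc, f.map_ids, g.map_ids]⟩
  id_comp f := Hom.ext (Category.id_comp f.graphHom)
  comp_id f := Hom.ext (Category.comp_id f.graphHom)
  assoc f g h := Hom.ext (Category.assoc f.graphHom g.graphHom h.graphHom)

variable (T S) in
/-- The forgetful functor from `T`-multicategories on `S` to `T`-graphs on `S`. -/
def forget : TMulticategory T S ⥤ TGraph T S where
  obj C := C.graph
  map f := f.graphHom

end TMulticategory

end Leinster

namespace Leinster

section SuitableCategory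

variable {E : Type u} [Category.{v} E]

theorem IsNested.of_succ (A : ℕ ⥤ E)
    (h : ∀ n, Mono (A.map (homOfLE (Nat.le_add_right n 1)))) : IsNested A := by
  intro m n f
  obtain ⟨k, rfl⟩ := Nat.exists_eq_add_of_le (leOfHom f)
  induction k with
  | zero =>
    rw [Subsingleton.elim f (𝟙 m), A.map_id]
    infer_instance
  | succ k ih =>
    rw [Subsingleton.elim f (homOfLE (Nat.le_add_right m k) ≫
      homOfLE (Nat.le_add_right (m + k) 1)), A.map_comp]
    have := ih (homOfLE (Nat.le_add_right m k))
    have := h (m + k)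
    exact mono_comp _ _

theorem IsNested.const (B : E) : IsNested ((Functor.const ℕ).obj B) := fun _ _ _ =>
  inferInstanceAs (Mono (𝟙 B))

/-- The identity cocone exhibits `B` as the colimit of the constant sequence at `B`. -/
def constIsColimit (B : E) :
    IsColimit (Cocone.mk B (𝟙 ((Functor.const ℕ).obj B))) where
  desc s := s.ι.app 0
  fac s n := by
    have := s.w (homOfLE (Nat.zero_le n))
    simp only [Functor.const_obj_map] at this
    simpa using this.symm
  uniq s m hm := by simpa using hm 0

theorem preservesPullbacks_of_isPullback {D : Type*} [Category* D] [HasPullbacks E] (F : E ⥤ D)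
    (h : ∀ {P X Y Z : E} {p : P ⟶ X} {q : P ⟶ Y} {f : X ⟶ Z} {g : Y ⟶ Z},
      IsPullback p q f g → IsPullback (F.map p) (F.map q) (F.map f) (F.map g)) :
    PreservesLimitsOfShape WalkingCospan F := by
  exact preservesLimitsOfShape_walkingCospan_of_forall_isPullback fun X Y Z f g _ =>
    ⟨_, _, _, IsPullback.of_hasPullback f g, h (IsPullback.of_hasPullback f g)⟩

theorem isPullback_of_mono_of_exists_lift {P X Y Z : E} {p : P ⟶ X} {q : P ⟶ Y} {f : X ⟶ Z}
    {g : Y ⟶ Z} [Mono p] [Mono g] (w : p ≫ f = q ≫ g)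
    (H : ∀ {W : E} (s : W ⟶ X) (t : W ⟶ Y), s ≫ f = t ≫ g → ∃ l : W ⟶ P, l ≫ p = s) :
    IsPullback p q f g := by
  choose l hl using fun s : PullbackCone f g => H s.fst s.snd s.condition
  exact ⟨⟨w⟩, ⟨PullbackCone.IsLimit.mk w l hl
    (fun s => by rw [← cancel_mono g, Category.assoc, ← w, ← s.condition, ← hl s, Category.assoc])
    (fun s m hm _ => by rw [← cancel_mono p, hm, hl])⟩⟩

variable [SuitableCategory E]

theorem mono_coprod_inl (A B : E) : Mono (coprod.inl : A ⟶ A ⨿ B) :=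
  SuitableCategory.mono_coproj _ _ (coprodIsCoprod A B) ⟨WalkingPair.left⟩

attribute [instance] mono_coprod_inl

/-- Binary coproducts are stable under pullback. -/
theorem nonempty_isColimit_of_isPullback {A B P Q C : E} {i : P ⟶ C} {j : Q ⟶ C}
    {a : P ⟶ A} {b : Q ⟶ B} {f : C ⟶ A ⨿ B}
    (hP : IsPullback i a f coprod.inl) (hQ : IsPullback j b f coprod.inr) :
    Nonempty (IsColimit (BinaryCofan.mk i j)) := by
  refine SuitableCategory.stable _ _ (coprodIsCoprod A B) (BinaryCofan.mk i j) (mapPair a b) f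
    ?_ (.of_discrete _) ?_
  · ext ⟨⟨⟩⟩
    · exact hP.w.symm
    · exact hQ.w.symm
  · rintro ⟨⟨⟩⟩
    · exact hP
    · exact hQ

instance : HasStrictInitialObjects E :=
  hasStrictInitial_of_isUniversal (SuitableCategory.stable _ _
    (BinaryCofan.IsColimit.mk _ (fun f _ => f) (fun f _ => Category.id_comp f)
      (fun _ _ => initialIsInitial.hom_ext _ _) (fun _ _ _ _ _ => initialIsInitial.hom_ext _ _)))

theorem mono_of_isInitial {A B : E} (hA : IsInitial A) (f : A ⟶ B) : Mono f := by
  constructor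
  intro Z g h _
  have := hA.isIso_to g
  exact (hA.ofIso (asIso g).symm).hom_ext _ _

/-- If two squares over a fixed map `k` are pullbacks then so is the square on coproducts. -/
theorem isPullback_coprod_desc {A A' B B' C D : E} {f : A ⟶ A'} {g : B ⟶ B'} {k : C ⟶ D}
    {a : A ⟶ C} {b : B ⟶ C} {a' : A' ⟶ D} {b' : B' ⟶ D}
    (hA : IsPullback a f k a') (hB : IsPullback b g k b') :
    IsPullback (coprod.desc a b) (coprod.map f g) k (coprod.desc a' b') := by
  let p : pullback k (coprod.desc a' b') ⟶ C := pullback.fst _ _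
  let q : pullback k (coprod.desc a' b') ⟶ A' ⨿ B' := pullback.snd _ _
  have hpq : IsPullback p q k (coprod.desc a' b') := IsPullback.of_hasPullback _ _
  let i : A ⟶ pullback k (coprod.desc a' b') :=
    hpq.lift a (f ≫ coprod.inl) (by simpa [coprod.inl_desc] using hA.w)
  let j : B ⟶ pullback k (coprod.desc a' b') :=
    hpq.lift b (g ≫ coprod.inr) (by simpa [coprod.inr_desc] using hB.w)
  have hi : IsPullback i f q coprod.inl := by
    refine IsPullback.of_right (h₁₂ := p) (h₂₂ := coprod.desc a' b') (v₁₃ := k) ?_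
      (hpq.lift_snd _ _ _) hpq
    rw [hpq.lift_fst, coprod.inl_desc]
    exact hA
  have hj : IsPullback j g q coprod.inr := by
    refine IsPullback.of_right (h₁₂ := p) (h₂₂ := coprod.desc a' b') (v₁₃ := k) ?_
      (hpq.lift_snd _ _ _) hpq
    rw [hpq.lift_fst, coprod.inr_desc]
    exact hB
  obtain ⟨hc⟩ := nonempty_isColimit_of_isPullback hi hj
  let e : A ⨿ B ≅ pullback k (coprod.desc a' b') :=
    (coprodIsCoprod A B).coconePointUniqueUpToIso hc
  have e₁ : coprod.inl ≫ e.hom = i :=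
    (coprodIsCoprod A B).comp_coconePointUniqueUpToIso_hom hc ⟨WalkingPair.left⟩
  have e₂ : coprod.inr ≫ e.hom = j :=
    (coprodIsCoprod A B).comp_coconePointUniqueUpToIso_hom hc ⟨WalkingPair.right⟩
  refine hpq.of_iso e.symm (Iso.refl _) (Iso.refl _) (Iso.refl _) ?_ ?_ (by simp) (by simp)
  · rw [Iso.symm_hom, Iso.eq_inv_comp]
    ext
    · rw [reassoc_of% e₁, coprod.inl_desc]
      simp [i]
    · rw [reassoc_of% e₂, coprod.inr_desc]
      simp [j]
  · rw [Iso.symm_hom, Iso.eq_inv_comp]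
    ext
    · rw [reassoc_of% e₁, coprod.inl_map]
      simp [i]
    · rw [reassoc_of% e₂, coprod.inr_map]
      simp [j]

/-- If two squares over a fixed map `k` are pullbacks then so is the square on coproducts. -/
theorem isPullback_of_isColimit_binaryCofan {A A' B B' P P' C D : E} {i : A ⟶ P} {j : B ⟶ P}
    {i' : A' ⟶ P'} {j' : B' ⟶ P'} (hs : IsColimit (BinaryCofan.mk i j))
    (hs' : IsColimit (BinaryCofan.mk i' j')) {f : A ⟶ A'} {g : B ⟶ B'} {k : C ⟶ D}
    {h : P ⟶ C} {h' : P' ⟶ D} {m : P ⟶ P'} (hf : i ≫ m = f ≫ i') (hg : j ≫ m = g ≫ j')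
    (hA : IsPullback (i ≫ h) f k (i' ≫ h')) (hB : IsPullback (j ≫ h) g k (j' ≫ h')) :
    IsPullback h m k h' := by
  let e : A ⨿ B ≅ P := (coprodIsCoprod A B).coconePointUniqueUpToIso hs
  let e' : A' ⨿ B' ≅ P' := (coprodIsCoprod A' B').coconePointUniqueUpToIso hs'
  have e₁ : coprod.inl ≫ e.hom = i :=
    (coprodIsCoprod A B).comp_coconePointUniqueUpToIso_hom hs ⟨WalkingPair.left⟩
  have e₂ : coprod.inr ≫ e.hom = j :=
    (coprodIsCoprod A B).comp_coconePointUniqueUpToIso_hom hs ⟨WalkingPair.right⟩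
  have e₁' : coprod.inl ≫ e'.hom = i' :=
    (coprodIsCoprod A' B').comp_coconePointUniqueUpToIso_hom hs' ⟨WalkingPair.left⟩
  have e₂' : coprod.inr ≫ e'.hom = j' :=
    (coprodIsCoprod A' B').comp_coconePointUniqueUpToIso_hom hs' ⟨WalkingPair.right⟩
  refine (isPullback_coprod_desc hA hB).of_iso e (Iso.refl _) e' (Iso.refl _) ?_ ?_ (by simp) ?_
  · ext
    · rw [coprod.inl_desc_assoc, reassoc_of% e₁, Iso.refl_hom, Category.comp_id]
    · rw [coprod.inr_desc_assoc, reassoc_of% e₂, Iso.refl_hom, Category.comp_id]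
  · ext
    · rw [coprod.inl_map_assoc, reassoc_of% e₁, e₁', hf]
    · rw [coprod.inr_map_assoc, reassoc_of% e₂, e₂', hg]
  · ext
    · rw [coprod.inl_desc_assoc, reassoc_of% e₁', Iso.refl_hom, Category.comp_id]
    · rw [coprod.inr_desc_assoc, reassoc_of% e₂', Iso.refl_hom, Category.comp_id]

theorem isPullback_coprod_inl {A A' B B' : E} (f : A ⟶ A') (g : B ⟶ B') :
    IsPullback coprod.inl f (coprod.map f g) coprod.inl := by
  refine isPullback_of_mono_of_exists_lift (coprod.inl_map f g) fun {W} s t h => ?_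
  have hB : IsInitial (pullback s coprod.inr) := by
    let z : pullback s coprod.inr ⟶ ⊥_ E := (SuitableCategory.disjoint A' B').lift
      (pullback.fst s coprod.inr ≫ t) (pullback.snd s coprod.inr ≫ g) (by
        rw [Category.assoc, ← h, pullback.condition_assoc, Category.assoc, coprod.inr_map])
    have := initialIsInitial.isIso_to z
    exact initialIsInitial.ofIso (asIso z).symm
  obtain ⟨hc⟩ := nonempty_isColimit_of_isPullback (IsPullback.of_hasPullback s coprod.inl)
    (IsPullback.of_hasPullback s coprod.inr)
  have : IsIso (pullback.fst s coprod.inl) := (BinaryCofan.isColimit_iff_isIso_inl hB _).1 ⟨hc⟩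
  exact ⟨inv (pullback.fst s coprod.inl) ≫ pullback.snd s coprod.inl, by
    rw [Category.assoc, ← pullback.condition, IsIso.inv_hom_id_assoc]⟩

theorem isPullback_coprod_inr {A A' B B' : E} (f : A ⟶ A') (g : B ⟶ B') :
    IsPullback coprod.inr g (coprod.map f g) coprod.inr := by
  refine (isPullback_coprod_inl g f).of_iso (Iso.refl _) (coprod.braiding _ _) (Iso.refl _)
    (coprod.braiding _ _) ?_ ?_ ?_ ?_
  all_goals simp [coprod.inl_desc]

theorem isPullback_coprod_map {P X Y Z P' X' Y' Z' : E} {p : P ⟶ X} {q : P ⟶ Y} {f : X ⟶ Z}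
    {g : Y ⟶ Z} {p' : P' ⟶ X'} {q' : P' ⟶ Y'} {f' : X' ⟶ Z'} {g' : Y' ⟶ Z'}
    (h : IsPullback p q f g) (h' : IsPullback p' q' f' g') :
    IsPullback (coprod.map p p') (coprod.map q q') (coprod.map f f') (coprod.map g g') := by
  have := isPullback_coprod_desc (h.paste_horiz (isPullback_coprod_inl f f'))
    (h'.paste_horiz (isPullback_coprod_inr f f'))
  simpa using this

instance mono_coprod_map {A A' B B' : E} (f : A ⟶ A') (g : B ⟶ B') [Mono f] [Mono g] :
    Mono (coprod.map f g) := by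
  rw [mono_iff_isPullback]
  have := isPullback_coprod_map ((mono_iff_isPullback f).1 inferInstance)
    ((mono_iff_isPullback g).1 inferInstance)
  rwa [coprod.map_id_id] at this

theorem isPullback_of_isInitial {P X Y Z : E} (hP : IsInitial P) (hY : IsInitial Y)
    {p : P ⟶ X} {q : P ⟶ Y} {f : X ⟶ Z} {g : Y ⟶ Z} : IsPullback p q f g := by
  have := mono_of_isInitial hP p
  have := mono_of_isInitial hY g
  refine isPullback_of_mono_of_exists_lift (hP.hom_ext _ _) fun {W} s t _ => ⟨t ≫ hY.to P, ?_⟩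
  have := hY.isIso_to t
  exact (hY.ofIso (asIso t).symm).hom_ext _ _

/-- A sequence of pullback squares over a fixed map induces a pullback square on colimits. -/
theorem isPullback_of_isColimit {A A' : ℕ ⥤ E} (hA' : IsNested A')
    {c : Cocone A} {c' : Cocone A'} (hc : IsColimit c) (hc' : IsColimit c') {C D : E} {k : C ⟶ D}
    {h : c.pt ⟶ C} {h' : c'.pt ⟶ D} {f : c.pt ⟶ c'.pt} (α : A ⟶ A')
    (hα : ∀ n, c.ι.app n ≫ f = α.app n ≫ c'.ι.app n)
    (H : ∀ n, IsPullback (c.ι.app n ≫ h) (α.app n) k (c'.ι.app n ≫ h')) :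
    IsPullback h f k h' := by
  let β : A ⟶ (Functor.const ℕ).obj C := c.ι ≫ (Functor.const ℕ).map h
  let β' : A' ⟶ (Functor.const ℕ).obj D := c'.ι ≫ (Functor.const ℕ).map h'
  have key : IsPullback β α ((Functor.const ℕ).map k) β' :=
    IsPullback.of_forall_isPullback_app H
  have := SuitableCategory.nested_pullback (IsNested.const C) hA' (IsNested.const D) key hc
    (constIsColimit C) hc' (constIsColimit D)
  convert this using 1
  · exact hc.hom_ext fun n => by simp [β]
  · exact hc.hom_ext fun n => by simp [hα]
  · exact (constIsColimit C).hom_ext fun n => by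
      rw [IsColimit.ι_map]
      simp
  · exact hc'.hom_ext fun n => by simp [β']

end SuitableCategory

open MonoidalCategory

section TensorSequence

variable {V : Type u} [Category.{v} V] [MonoidalCategory V]

/-- The pointwise tensor product of two sequences. -/
def tensorSeq (F G : ℕ ⥤ V) : ℕ ⥤ V where
  obj n := F.obj n ⊗ G.obj n
  map f := F.map f ⊗ₘ G.map f

/-- The pointwise tensor product of cocones on two sequences. -/
def tensorCocone {F G : ℕ ⥤ V} (c : Cocone F) (d : Cocone G) : Cocone (tensorSeq F G) where
  pt := c.pt ⊗ d.pt
  ι :=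
    { app := fun n => c.ι.app n ⊗ₘ d.ι.app n
      naturality := fun m n f => by
        dsimp [tensorSeq]
        rw [tensorHom_comp_tensorHom, c.w, d.w, Category.comp_id] }

end TensorSequence

/-- A monoidal structure on a suitable category whose tensor product preserves pullbacks and
colimits of nested sequences (in both variables jointly) and, in the left variable, finite
coproducts. -/
class SuitableMonoidal (V : Type u) [Category.{v} V] [SuitableCategory V]
    [MonoidalCategory V] : Prop where
  tensor_isPullback : ∀ {P X Y Z P' X' Y' Z' : V} {p : P ⟶ X} {q : P ⟶ Y} {f : X ⟶ Z}
    {g : Y ⟶ Z} {p' : P' ⟶ X'} {q' : P' ⟶ Y'} {f' : X' ⟶ Z'} {g' : Y' ⟶ Z'},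
    IsPullback p q f g → IsPullback p' q' f' g' →
      IsPullback (p ⊗ₘ p') (q ⊗ₘ q') (f ⊗ₘ f') (g ⊗ₘ g')
  preservesFiniteCoproducts_tensorRight : ∀ B : V, PreservesFiniteCoproducts (tensorRight B)
  nonempty_isColimit_tensorCocone : ∀ {F G : ℕ ⥤ V}, IsNested F → IsNested G →
    ∀ {c : Cocone F} {d : Cocone G}, IsColimit c → IsColimit d →
      Nonempty (IsColimit (tensorCocone c d))

namespace FreeMonoid

variable {V : Type u} [Category.{v} V] [SuitableCategory V] [MonoidalCategory V]

/-- The objects of the chain `0 ⟶ 1 + X ⊗ 0 ⟶ 1 + X ⊗ (1 + X ⊗ 0) ⟶ ⋯`. -/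
noncomputable def chainObj (X : V) : ℕ → V
  | 0 => ⊥_ V
  | n + 1 => 𝟙_ V ⨿ (X ⊗ chainObj X n)

/-- The maps of the chain `0 ⟶ 1 + X ⊗ 0 ⟶ 1 + X ⊗ (1 + X ⊗ 0) ⟶ ⋯`. -/
noncomputable def chainMap (X : V) : ∀ n, chainObj X n ⟶ chainObj X (n + 1)
  | 0 => initial.to _
  | n + 1 => coprod.map (𝟙 _) (X ◁ chainMap X n)

/-- The summand `1` of a stage of the chain. -/
noncomputable def injOne (X : V) (n : ℕ) : 𝟙_ V ⟶ chainObj X (n + 1) := coprod.inl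

/-- The summand `X ⊗ -` of a stage of the chain. -/
noncomputable def injAct (X : V) (n : ℕ) : X ⊗ chainObj X n ⟶ chainObj X (n + 1) := coprod.inr

@[simp]
theorem injOne_chainMap (X : V) (n : ℕ) :
    injOne X n ≫ chainMap X (n + 1) = injOne X (n + 1) :=
  (coprod.inl_map (𝟙 _) (X ◁ chainMap X n)).trans (Category.id_comp _)

@[simp]
theorem injAct_chainMap (X : V) (n : ℕ) :
    injAct X n ≫ chainMap X (n + 1) = X ◁ chainMap X n ≫ injAct X (n + 1) :=
  coprod.inr_map (𝟙 _) (X ◁ chainMap X n)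

theorem chainObj_succ_hom_ext {X W : V} {n : ℕ} {f g : chainObj X (n + 1) ⟶ W}
    (h₁ : injOne X n ≫ f = injOne X n ≫ g) (h₂ : injAct X n ≫ f = injAct X n ≫ g) : f = g :=
  coprod.hom_ext h₁ h₂

/-- The chain `0 ⟶ 1 + X ⊗ 0 ⟶ 1 + X ⊗ (1 + X ⊗ 0) ⟶ ⋯`. -/
noncomputable abbrev chain (X : V) : ℕ ⥤ V := Functor.ofSequence (chainMap X)

/-- The action of a map on the stages of the chain. -/
noncomputable def stageMap {X Y : V} (f : X ⟶ Y) : ∀ n, chainObj X n ⟶ chainObj Y n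
  | 0 => 𝟙 _
  | n + 1 => coprod.map (𝟙 _) (f ⊗ₘ stageMap f n)

@[simp]
theorem injOne_stageMap {X Y : V} (f : X ⟶ Y) (n : ℕ) :
    injOne X n ≫ stageMap f (n + 1) = injOne Y n :=
  (coprod.inl_map (𝟙 _) (f ⊗ₘ stageMap f n)).trans (Category.id_comp _)

@[simp]
theorem injAct_stageMap {X Y : V} (f : X ⟶ Y) (n : ℕ) :
    injAct X n ≫ stageMap f (n + 1) = (f ⊗ₘ stageMap f n) ≫ injAct Y n :=
  coprod.inr_map (𝟙 _) (f ⊗ₘ stageMap f n)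

theorem stageMap_chainMap {X Y : V} (f : X ⟶ Y) :
    ∀ n, stageMap f n ≫ chainMap Y n = chainMap X n ≫ stageMap f (n + 1)
  | 0 => initialIsInitial.hom_ext _ _
  | n + 1 => by
    refine chainObj_succ_hom_ext ?_ ?_
    · rw [reassoc_of% @injOne_stageMap, injOne_chainMap, reassoc_of% @injOne_chainMap,
        injOne_stageMap]
    · rw [reassoc_of% @injAct_stageMap, injAct_chainMap, reassoc_of% @injAct_chainMap,
        injAct_stageMap, ← id_tensorHom, ← id_tensorHom, tensorHom_comp_tensorHom_assoc,
        tensorHom_comp_tensorHom_assoc, stageMap_chainMap f n, Category.id_comp, Category.comp_id]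

/-- The map of chains induced by a map. -/
noncomputable def chainNatTrans {X Y : V} (f : X ⟶ Y) : chain X ⟶ chain Y :=
  NatTrans.ofSequence (stageMap f) fun n => by
    rw [Functor.ofSequence_map_homOfLE_succ, Functor.ofSequence_map_homOfLE_succ]
    exact (stageMap_chainMap f n).symm

variable [SuitableMonoidal V]

open SuitableMonoidal

instance (B : V) : PreservesFiniteCoproducts (tensorRight B) :=
  preservesFiniteCoproducts_tensorRight B

instance mono_tensorHom {X Y X' Y' : V} (f : X ⟶ Y) (f' : X' ⟶ Y') [Mono f] [Mono f'] :
    Mono (f ⊗ₘ f') := by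
  rw [mono_iff_isPullback]
  have := tensor_isPullback ((mono_iff_isPullback f).1 inferInstance)
    ((mono_iff_isPullback f').1 inferInstance)
  rwa [id_tensorHom_id] at this

theorem IsNested.tensorSeq {F G : ℕ ⥤ V} (hF : IsNested F) (hG : IsNested G) :
    IsNested (tensorSeq F G) := fun _ _ f => by
  have := hF f
  have := hG f
  exact mono_tensorHom (F.map f) (G.map f)

instance mono_whiskerLeft (X : V) {Y Z : V} (f : Y ⟶ Z) [Mono f] : Mono (X ◁ f) := by
  rw [← id_tensorHom]
  infer_instance

/-- Tensoring an initial object on the right yields an initial object. -/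
noncomputable def isInitialTensor {A : V} (hA : IsInitial A) (B : V) : IsInitial (A ⊗ B) :=
  hA.isInitialObj (tensorRight B)

/-- The tensor product on the right of a binary coproduct is a coproduct. -/
noncomputable def coprodTensorIsColimit (P Q B : V) :
    IsColimit (BinaryCofan.mk ((coprod.inl : P ⟶ P ⨿ Q) ▷ B) ((coprod.inr : Q ⟶ P ⨿ Q) ▷ B)) :=
  mapIsColimitOfPreservesOfIsColimit (tensorRight B) _ _ (coprodIsCoprod P Q)

/-- Maps out of `(P ⨿ Q) ⊗ B`. -/
noncomputable def coprodTensorDesc {P Q B C : V} (f : P ⊗ B ⟶ C) (g : Q ⊗ B ⟶ C) :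
    (P ⨿ Q) ⊗ B ⟶ C :=
  (BinaryCofan.IsColimit.desc' (coprodTensorIsColimit P Q B) f g).1

@[simp]
theorem inl_coprodTensorDesc {P Q B C : V} (f : P ⊗ B ⟶ C) (g : Q ⊗ B ⟶ C) :
    coprod.inl ▷ B ≫ coprodTensorDesc f g = f :=
  (BinaryCofan.IsColimit.desc' (coprodTensorIsColimit P Q B) f g).2.1

@[simp]
theorem inr_coprodTensorDesc {P Q B C : V} (f : P ⊗ B ⟶ C) (g : Q ⊗ B ⟶ C) :
    coprod.inr ▷ B ≫ coprodTensorDesc f g = g :=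
  (BinaryCofan.IsColimit.desc' (coprodTensorIsColimit P Q B) f g).2.2

theorem coprodTensor_hom_ext {P Q B C : V} {f g : (P ⨿ Q) ⊗ B ⟶ C}
    (h₁ : coprod.inl ▷ B ≫ f = coprod.inl ▷ B ≫ g)
    (h₂ : coprod.inr ▷ B ≫ f = coprod.inr ▷ B ≫ g) : f = g :=
  BinaryCofan.IsColimit.hom_ext (coprodTensorIsColimit P Q B) h₁ h₂

theorem chainObj_succ_tensor_hom_ext {X B W : V} {n : ℕ} {f g : chainObj X (n + 1) ⊗ B ⟶ W}
    (h₁ : injOne X n ▷ B ≫ f = injOne X n ▷ B ≫ g)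
    (h₂ : injAct X n ▷ B ≫ f = injAct X n ▷ B ≫ g) : f = g :=
  coprodTensor_hom_ext h₁ h₂

theorem mono_chainMap (X : V) : ∀ n, Mono (chainMap X n)
  | 0 => mono_of_isInitial initialIsInitial _
  | n + 1 => by
    have := mono_chainMap X n
    exact mono_coprod_map (𝟙 (𝟙_ V)) (X ◁ chainMap X n)

theorem isNested_chain (X : V) : IsNested (chain X) :=
  IsNested.of_succ _ fun n => by
    rw [Functor.ofSequence_map_homOfLE_succ]
    exact mono_chainMap X n

instance (X : V) : HasColimit (chain X) :=
  SuitableCategory.hasColimit_nested _ (isNested_chain X)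

/-- The underlying object of the free monoid on `X`: the colimit of the chain. -/
noncomputable def freeObj (X : V) : V := colimit (chain X)

/-- The coprojections of the chain into the free monoid. -/
noncomputable def incl (X : V) (n : ℕ) : chainObj X n ⟶ freeObj X := colimit.ι (chain X) n

/-- The colimit cocone of the chain. -/
noncomputable def freeCocone (X : V) : Cocone (chain X) := colimit.cocone (chain X)

/-- The free monoid is the colimit of the chain. -/
noncomputable def freeCoconeIsColimit (X : V) : IsColimit (freeCocone X) :=
  colimit.isColimit (chain X)

theorem chainMap_incl (X : V) (n : ℕ) : chainMap X n ≫ incl X (n + 1) = incl X n := by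
  rw [← Functor.ofSequence_map_homOfLE_succ (chainMap X)]
  exact colimit.w (chain X) _

/-- `X ⊗ -` applied to the chain has the expected colimit. -/
noncomputable def tensorFreeIsColimit (X B : V) :
    IsColimit (tensorCocone (Cocone.mk B (𝟙 ((Functor.const ℕ).obj B))) (freeCocone X)) :=
  (nonempty_isColimit_tensorCocone (IsNested.const B) (isNested_chain X) (constIsColimit B)
    (freeCoconeIsColimit X)).some

/-- `- ⊗ B` applied to the chain has the expected colimit. -/
noncomputable def freeTensorIsColimit (X B : V) :
    IsColimit (tensorCocone (freeCocone X) (Cocone.mk B (𝟙 ((Functor.const ℕ).obj B)))) :=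
  (nonempty_isColimit_tensorCocone (isNested_chain X) (IsNested.const B)
    (freeCoconeIsColimit X) (constIsColimit B)).some

/-- A cocone on a sequence from a family of maps compatible with successors. -/
def coconeOfSucc {F : ℕ ⥤ V} {W : V} (w : ∀ n, F.obj n ⟶ W)
    (hw : ∀ n, F.map (homOfLE (Nat.le_add_right n 1)) ≫ w (n + 1) = w n) : Cocone F where
  pt := W
  ι := NatTrans.ofSequence w fun n => by simp [hw]

theorem freeTensor_hom_ext {X B W : V} {f g : freeObj X ⊗ B ⟶ W}
    (h : ∀ n, incl X n ▷ B ≫ f = incl X n ▷ B ≫ g) : f = g :=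
  (freeTensorIsColimit X B).hom_ext fun n => by
    have : (tensorCocone (freeCocone X) (Cocone.mk B (𝟙 ((Functor.const ℕ).obj B)))).ι.app n =
      incl X n ▷ B := tensorHom_id _ _
    rw [this]
    exact h n

theorem exists_tensorFree_desc {X B W : V} (w : ∀ n, B ⊗ chainObj X n ⟶ W)
    (hw : ∀ n, B ◁ chainMap X n ≫ w (n + 1) = w n) :
    ∃ l : B ⊗ freeObj X ⟶ W, ∀ n, B ◁ incl X n ≫ l = w n := by
  let s : Cocone (tensorSeq ((Functor.const ℕ).obj B) (chain X)) := coconeOfSucc w fun n => by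
    rw [← hw n, ← id_tensorHom, ← Functor.ofSequence_map_homOfLE_succ (chainMap X) n]
    rfl
  refine ⟨(tensorFreeIsColimit X B).desc s, fun n => ?_⟩
  rw [← id_tensorHom]
  exact (tensorFreeIsColimit X B).fac s n

theorem exists_freeTensor_desc {X B W : V} (w : ∀ n, chainObj X n ⊗ B ⟶ W)
    (hw : ∀ n, chainMap X n ▷ B ≫ w (n + 1) = w n) :
    ∃ l : freeObj X ⊗ B ⟶ W, ∀ n, incl X n ▷ B ≫ l = w n := by
  let s : Cocone (tensorSeq (chain X) ((Functor.const ℕ).obj B)) := coconeOfSucc w fun n => by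
    rw [← hw n, ← tensorHom_id, ← Functor.ofSequence_map_homOfLE_succ (chainMap X) n]
    rfl
  refine ⟨(freeTensorIsColimit X B).desc s, fun n => ?_⟩
  rw [← tensorHom_id]
  exact (freeTensorIsColimit X B).fac s n

/-- The unit of the free monoid. -/
noncomputable def one (X : V) : 𝟙_ V ⟶ freeObj X := injOne X 0 ≫ incl X 1

@[simp]
theorem injOne_incl (X : V) : ∀ n, injOne X n ≫ incl X (n + 1) = one X
  | 0 => rfl
  | n + 1 => by rw [← injOne_incl X n, ← chainMap_incl X (n + 1), reassoc_of% @injOne_chainMap]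

theorem exists_act (X : V) : ∃ a : X ⊗ freeObj X ⟶ freeObj X,
    ∀ n, X ◁ incl X n ≫ a = injAct X n ≫ incl X (n + 1) :=
  exists_tensorFree_desc _ fun n => by rw [← chainMap_incl X (n + 1), reassoc_of% @injAct_chainMap]

/-- The action of `X` on the free monoid on `X`. -/
noncomputable def act (X : V) : X ⊗ freeObj X ⟶ freeObj X := (exists_act X).choose

theorem whiskerLeft_incl_act (X : V) (n : ℕ) :
    X ◁ incl X n ≫ act X = injAct X n ≫ incl X (n + 1) :=
  (exists_act X).choose_spec n

section Recursion

variable {X B C : V} (b : B ⟶ C) (c : X ⊗ C ⟶ C)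

/-- The stages of the map out of `freeObj X ⊗ B` determined by `b` and `c`. -/
noncomputable def descStage : ∀ n, chainObj X n ⊗ B ⟶ C
  | 0 => (isInitialTensor initialIsInitial B).to C
  | n + 1 => coprodTensorDesc ((λ_ B).hom ≫ b) ((α_ _ _ _).hom ≫ X ◁ descStage n ≫ c)

@[simp]
theorem injOne_descStage (n : ℕ) :
    injOne X n ▷ B ≫ descStage b c (n + 1) = (λ_ B).hom ≫ b :=
  inl_coprodTensorDesc _ _

@[simp]
theorem injAct_descStage (n : ℕ) :
    injAct X n ▷ B ≫ descStage b c (n + 1) = (α_ _ _ _).hom ≫ X ◁ descStage b c n ≫ c :=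
  inr_coprodTensorDesc _ _

theorem chainMap_descStage : ∀ n, chainMap X n ▷ B ≫ descStage b c (n + 1) = descStage b c n
  | 0 => (isInitialTensor initialIsInitial B).hom_ext _ _
  | n + 1 => by
    refine chainObj_succ_tensor_hom_ext ?_ ?_
    · rw [← comp_whiskerRight_assoc, injOne_chainMap, injOne_descStage, injOne_descStage]
    · rw [← comp_whiskerRight_assoc, injAct_chainMap, comp_whiskerRight_assoc, injAct_descStage,
        associator_naturality_middle_assoc, ← whiskerLeft_comp_assoc, chainMap_descStage n,
        injAct_descStage]

theorem exists_desc : ∃ h : freeObj X ⊗ B ⟶ C, ∀ n, incl X n ▷ B ≫ h = descStage b c n :=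
  exists_freeTensor_desc _ (chainMap_descStage b c)

/-- The map out of `freeObj X ⊗ B` determined by `b` and `c`. -/
noncomputable def desc : freeObj X ⊗ B ⟶ C := (exists_desc b c).choose

theorem incl_desc (n : ℕ) : incl X n ▷ B ≫ desc b c = descStage b c n :=
  (exists_desc b c).choose_spec n

@[simp]
theorem one_desc : one X ▷ B ≫ desc b c = (λ_ B).hom ≫ b := by
  rw [one, comp_whiskerRight_assoc, incl_desc, injOne_descStage]

theorem tensorFreeTensor_hom_ext {W : V} {f g : (X ⊗ freeObj X) ⊗ B ⟶ W}
    (h : ∀ n, (X ◁ incl X n) ▷ B ≫ f = (X ◁ incl X n) ▷ B ≫ g) : f = g := by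
  obtain ⟨hc⟩ := nonempty_isColimit_tensorCocone
    (IsNested.tensorSeq (IsNested.const X) (isNested_chain X)) (IsNested.const B)
    (tensorFreeIsColimit X X) (constIsColimit B)
  refine hc.hom_ext fun n => ?_
  have := h n
  rw [← id_tensorHom, ← tensorHom_id] at this
  exact this

@[simp]
theorem act_desc : act X ▷ B ≫ desc b c = (α_ _ _ _).hom ≫ X ◁ desc b c ≫ c := by
  refine tensorFreeTensor_hom_ext fun n => ?_
  rw [← comp_whiskerRight_assoc, whiskerLeft_incl_act, comp_whiskerRight_assoc, incl_desc,
    injAct_descStage, associator_naturality_middle_assoc, ← whiskerLeft_comp_assoc,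
    incl_desc]

variable {b c}

theorem eq_desc {h : freeObj X ⊗ B ⟶ C} (h₁ : one X ▷ B ≫ h = (λ_ B).hom ≫ b)
    (h₂ : act X ▷ B ≫ h = (α_ _ _ _).hom ≫ X ◁ h ≫ c) : h = desc b c := by
  refine freeTensor_hom_ext fun n => ?_
  rw [incl_desc]
  induction n with
  | zero => exact (isInitialTensor initialIsInitial B).hom_ext _ _
  | succ n ih =>
    refine chainObj_succ_tensor_hom_ext ?_ ?_
    · rw [← comp_whiskerRight_assoc, injOne_incl, h₁, injOne_descStage]
    · rw [← comp_whiskerRight_assoc, ← whiskerLeft_incl_act, comp_whiskerRight_assoc, h₂,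
        associator_naturality_middle_assoc, ← whiskerLeft_comp_assoc, ih, injAct_descStage]

theorem desc_hom_ext {h h' : freeObj X ⊗ B ⟶ C} (h₁ : one X ▷ B ≫ h = (λ_ B).hom ≫ b)
    (h₂ : act X ▷ B ≫ h = (α_ _ _ _).hom ≫ X ◁ h ≫ c)
    (h₁' : one X ▷ B ≫ h' = (λ_ B).hom ≫ b)
    (h₂' : act X ▷ B ≫ h' = (α_ _ _ _).hom ≫ X ◁ h' ≫ c) : h = h' :=
  (eq_desc h₁ h₂).trans (eq_desc h₁' h₂').symm

end Recursion

end FreeMonoid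

open MonoidalCategory

namespace FreeMonoid

variable {V : Type u} [Category.{v} V] [SuitableCategory V] [MonoidalCategory V]
  [SuitableMonoidal V]

/-- The multiplication of the free monoid. -/
noncomputable def mul (X : V) : freeObj X ⊗ freeObj X ⟶ freeObj X := desc (𝟙 _) (act X)

@[simp]
theorem one_mul (X : V) : one X ▷ freeObj X ≫ mul X = (λ_ (freeObj X)).hom := by
  rw [mul, one_desc, Category.comp_id]

@[simp]
theorem act_mul (X : V) :
    act X ▷ freeObj X ≫ mul X = (α_ _ _ _).hom ≫ X ◁ mul X ≫ act X :=
  act_desc _ _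

@[simp]
theorem mul_one (X : V) : freeObj X ◁ one X ≫ mul X = (ρ_ (freeObj X)).hom := by
  refine desc_hom_ext (b := one X) (c := act X) ?_ ?_ ?_ ?_
  · rw [← whisker_exchange_assoc, one_mul, leftUnitor_naturality]
  · rw [← whisker_exchange_assoc, act_mul, tensor_whiskerLeft_assoc, Iso.inv_hom_id_assoc,
      whiskerLeft_comp_assoc]
  · rw [rightUnitor_naturality, unitors_equal]
  · rw [rightUnitor_naturality, rightUnitor_tensor_hom_assoc]

theorem mul_assoc (X : V) : mul X ▷ freeObj X ≫ mul X =
    (α_ _ _ _).hom ≫ freeObj X ◁ mul X ≫ mul X := by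
  rw [← Iso.inv_comp_eq]
  refine desc_hom_ext (b := mul X) (c := act X) ?_ ?_ ?_ ?_
  · rw [associator_inv_naturality_left_assoc, ← comp_whiskerRight_assoc, one_mul,
      leftUnitor_whiskerRight, Category.assoc, Iso.inv_hom_id_assoc]
  · rw [associator_inv_naturality_left_assoc, ← comp_whiskerRight_assoc, act_mul]
    simp only [comp_whiskerRight, Category.assoc, act_mul, associator_naturality_middle_assoc,
      whiskerLeft_comp]
    simp only [pentagon_inv_hom_hom_hom_inv_assoc]
  · rw [← whisker_exchange_assoc, one_mul, leftUnitor_naturality]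
  · rw [← whisker_exchange_assoc, act_mul, tensor_whiskerLeft_assoc, Iso.inv_hom_id_assoc,
      whiskerLeft_comp_assoc]

noncomputable instance (X : V) : MonObj (freeObj X) where
  one := one X
  mul := mul X
  one_mul := one_mul X
  mul_one := mul_one X
  mul_assoc := mul_assoc X

/-- The free monoid on `X`. -/
noncomputable abbrev freeMon (X : V) : Mon V := Mon.mk (freeObj X)

/-- The inclusion of generators. -/
noncomputable def gen (X : V) : X ⟶ freeObj X := (ρ_ X).inv ≫ X ◁ one X ≫ act X

theorem gen_mul (X : V) : gen X ▷ freeObj X ≫ mul X = act X := by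
  simp only [gen, comp_whiskerRight, Category.assoc, act_mul, associator_naturality_middle_assoc]
  rw [← whiskerLeft_comp_assoc, one_mul]
  simp

section Algebra

variable {X C : V} (b : 𝟙_ V ⟶ C) (c : X ⊗ C ⟶ C)

/-- The map out of `freeObj X` determined by `b` and `c`. -/
noncomputable def fold : freeObj X ⟶ C := (ρ_ (freeObj X)).inv ≫ desc b c

@[simp]
theorem one_fold : one X ≫ fold b c = b := by
  rw [fold, rightUnitor_inv_naturality_assoc, one_desc, unitors_equal, Iso.inv_hom_id_assoc]

@[simp]
theorem act_fold : act X ≫ fold b c = X ◁ fold b c ≫ c := by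
  rw [fold, rightUnitor_inv_naturality_assoc, act_desc]
  simp

variable {b c}

theorem eq_fold {h : freeObj X ⟶ C} (h₁ : one X ≫ h = b) (h₂ : act X ≫ h = X ◁ h ≫ c) :
    h = fold b c := by
  rw [fold, Iso.eq_inv_comp]
  refine eq_desc ?_ ?_
  · rw [rightUnitor_naturality_assoc, h₁, unitors_equal]
  · rw [rightUnitor_naturality_assoc, h₂, rightUnitor_tensor_hom_assoc, whiskerLeft_comp_assoc]

theorem fold_hom_ext {h h' : freeObj X ⟶ C} (h₁ : one X ≫ h = b) (h₂ : act X ≫ h = X ◁ h ≫ c)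
    (h₁' : one X ≫ h' = b) (h₂' : act X ≫ h' = X ◁ h' ≫ c) : h = h' :=
  (eq_fold h₁ h₂).trans (eq_fold h₁' h₂').symm

end Algebra

section Lift

open MonObj

variable {X : V} {M : V} [MonObj M] (f : X ⟶ M)

/-- The map from the free monoid on `X` to a monoid which extends `f`. -/
noncomputable def lift : freeObj X ⟶ M := fold η (f ▷ M ≫ μ)

theorem mul_lift : mul X ≫ lift f = (lift f ⊗ₘ lift f) ≫ μ := by
  refine desc_hom_ext (b := lift f) (c := f ▷ M ≫ μ) ?_ ?_ ?_ ?_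
  · rw [reassoc_of% @one_mul]
  · rw [reassoc_of% @act_mul, lift, act_fold, whiskerLeft_comp_assoc]
  · rw [MonoidalCategory.tensorHom_def, Category.assoc, ← comp_whiskerRight_assoc, lift, one_fold,
      ← whisker_exchange_assoc, MonObj.one_mul, leftUnitor_naturality]
  · rw [MonoidalCategory.tensorHom_def, Category.assoc, ← comp_whiskerRight_assoc, lift, act_fold]
    simp only [comp_whiskerRight, whisker_assoc, Category.assoc, ← whisker_exchange_assoc,
      MonObj.mul_assoc, tensor_whiskerLeft, Iso.inv_hom_id_assoc, whiskerLeft_comp,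
      associator_naturality_left_assoc]
    rw [← whiskerLeft_comp_assoc X (freeObj X ◁ _), whisker_exchange, whiskerLeft_comp_assoc]

instance isMonHom_lift : IsMonHom (lift f) where
  one_hom := one_fold _ _
  mul_hom := mul_lift f

@[simp]
theorem gen_lift : gen X ≫ lift f = f := by
  rw [gen, lift, Category.assoc, Category.assoc, act_fold, ← whiskerLeft_comp_assoc, one_fold,
    whisker_exchange_assoc, MonObj.mul_one]
  simp

theorem act_isMonHom (g : freeObj X ⟶ M) [IsMonHom g] :
    act X ≫ g = X ◁ g ≫ (gen X ≫ g) ▷ M ≫ μ := by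
  rw [← gen_mul, Category.assoc]
  have : mul X ≫ g = (g ⊗ₘ g) ≫ μ := IsMonHom.mul_hom g
  rw [this, MonoidalCategory.tensorHom_def, comp_whiskerRight_assoc, whisker_exchange_assoc,
    Category.assoc, ← whisker_exchange_assoc, ← whisker_exchange_assoc]

theorem eq_lift (g : freeObj X ⟶ M) [IsMonHom g] (hg : gen X ≫ g = f) : g = lift f := by
  subst hg
  exact eq_fold (IsMonHom.one_hom g) (act_isMonHom g)

end Lift

/-- Monoid maps out of the free monoid on `X` are maps out of `X`. -/
noncomputable def homEquiv (X : V) (M : Mon V) : (freeMon X ⟶ M) ≃ (X ⟶ (Mon.forget V).obj M) where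
  toFun g := gen X ≫ g.hom
  invFun f := @Mon.Hom.mk _ _ _ (freeMon X) M (lift (M := M.X) f) (isMonHom_lift (M := M.X) f)
  left_inv g := by
    ext
    exact (eq_lift _ g.hom rfl).symm
  right_inv f := gen_lift (M := M.X) f

/-- The free monoid functor. -/
noncomputable def free : V ⥤ Mon V :=
  Adjunction.leftAdjointOfEquiv (G := Mon.forget V) homEquiv fun X M N g h => by
    exact (Category.assoc _ _ _).symm

variable (V) in
/-- The free monoid functor is left adjoint to the forgetful functor. -/
noncomputable def adj : free ⊣ Mon.forget V := Adjunction.adjunctionOfEquivLeft _ _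

theorem adj_unit_app (X : V) : (adj V).unit.app X = gen X :=
  Category.comp_id (gen X)

theorem free_map_hom {X Y : V} (f : X ⟶ Y) : (free.map f).hom = lift (f ≫ gen Y) :=
  congrArg (fun t => lift (f ≫ t)) (Category.comp_id (gen Y))

end FreeMonoid

open MonoidalCategory

namespace FreeMonoid

variable {V : Type u} [Category.{v} V] [SuitableCategory V] [MonoidalCategory V]
  [SuitableMonoidal V]

open SuitableMonoidal

/-- The map of free monoids induced by a map. -/
noncomputable def freeMap {X Y : V} (f : X ⟶ Y) : freeObj X ⟶ freeObj Y := lift (f ≫ gen Y)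

@[simp]
theorem one_freeMap {X Y : V} (f : X ⟶ Y) : one X ≫ freeMap f = one Y :=
  one_fold _ _

@[simp]
theorem act_freeMap {X Y : V} (f : X ⟶ Y) :
    act X ≫ freeMap f = (f ⊗ₘ freeMap f) ≫ act Y := by
  refine (act_fold _ _).trans ?_
  have : (f ≫ gen Y) ▷ freeObj Y ≫ mul Y = f ▷ freeObj Y ≫ act Y := by
    rw [comp_whiskerRight_assoc, gen_mul]
  rw [MonoidalCategory.tensorHom_def', Category.assoc]
  exact congrArg (X ◁ freeMap f ≫ ·) this

theorem incl_freeMap {X Y : V} (f : X ⟶ Y) :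
    ∀ n, incl X n ≫ freeMap f = stageMap f n ≫ incl Y n
  | 0 => initialIsInitial.hom_ext _ _
  | n + 1 => by
    refine chainObj_succ_hom_ext ?_ ?_
    · rw [reassoc_of% @injOne_incl, one_freeMap, reassoc_of% @injOne_stageMap, injOne_incl]
    · rw [← Category.assoc, ← whiskerLeft_incl_act, Category.assoc, act_freeMap,
        reassoc_of% @injAct_stageMap, ← whiskerLeft_incl_act, ← id_tensorHom, ← id_tensorHom,
        tensorHom_comp_tensorHom_assoc, tensorHom_comp_tensorHom_assoc, incl_freeMap f n,
        Category.id_comp, Category.comp_id]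

/-- The free monoid on `X` is the coproduct of `1` and `X ⊗ freeObj X`. -/
noncomputable def freeIso (X : V) : 𝟙_ V ⨿ (X ⊗ freeObj X) ≅ freeObj X where
  hom := coprod.desc (one X) (act X)
  inv := fold coprod.inl (X ◁ coprod.desc (one X) (act X) ≫ coprod.inr)
  hom_inv_id := by
    have : fold coprod.inl (X ◁ coprod.desc (one X) (act X) ≫ coprod.inr) ≫
        coprod.desc (one X) (act X) = 𝟙 (freeObj X) := by
      refine fold_hom_ext (b := one X) (c := act X) ?_ ?_ ?_ ?_
      · rw [reassoc_of% @one_fold, coprod.inl_desc]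
      · rw [reassoc_of% @act_fold, Category.assoc, coprod.inr_desc, whiskerLeft_comp_assoc]
      · rw [Category.comp_id]
      · rw [Category.comp_id, whiskerLeft_id, Category.id_comp]
    ext
    · rw [coprod.inl_desc_assoc, one_fold, Category.comp_id]
    · rw [coprod.inr_desc_assoc, act_fold, ← whiskerLeft_comp_assoc, this, whiskerLeft_id,
        Category.id_comp, Category.comp_id]
  inv_hom_id := by
    refine fold_hom_ext (b := one X) (c := act X) ?_ ?_ ?_ ?_
    · rw [reassoc_of% @one_fold, coprod.inl_desc]
    · rw [reassoc_of% @act_fold, Category.assoc, coprod.inr_desc, whiskerLeft_comp_assoc]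
    · rw [Category.comp_id]
    · rw [Category.comp_id, whiskerLeft_id, Category.id_comp]

theorem freeIso_hom_freeMap {X Y : V} (f : X ⟶ Y) :
    coprod.map (𝟙 _) (f ⊗ₘ freeMap f) ≫ (freeIso Y).hom = (freeIso X).hom ≫ freeMap f := by
  ext
  · simp [freeIso, coprod.inl_desc]
  · simp [freeIso, coprod.inr_desc]

theorem isPullback_one {X Y : V} (f : X ⟶ Y) :
    IsPullback (one X) (𝟙 _) (freeMap f) (one Y) :=
  (isPullback_coprod_inl (𝟙 (𝟙_ V)) (f ⊗ₘ freeMap f)).of_iso (Iso.refl _) (freeIso X)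
    (Iso.refl _) (freeIso Y) (by simp [freeIso, coprod.inl_desc]) (by simp)
    (freeIso_hom_freeMap f) (by simp [freeIso, coprod.inl_desc])

theorem isPullback_act {X Y : V} (f : X ⟶ Y) :
    IsPullback (act X) (f ⊗ₘ freeMap f) (freeMap f) (act Y) :=
  (isPullback_coprod_inr (𝟙 (𝟙_ V)) (f ⊗ₘ freeMap f)).of_iso (Iso.refl _) (freeIso X)
    (Iso.refl _) (freeIso Y) (by simp [freeIso, coprod.inr_desc]) (by simp)
    (freeIso_hom_freeMap f) (by simp [freeIso, coprod.inr_desc])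

theorem isPullback_gen {X Y : V} (f : X ⟶ Y) :
    IsPullback (gen X) f (freeMap f) (gen Y) := by
  have h₁ : IsPullback (X ◁ one X) (f ▷ 𝟙_ V) (f ⊗ₘ freeMap f) (Y ◁ one Y) := by
    simpa using tensor_isPullback (IsPullback.of_id_fst (f := f)) (isPullback_one f)
  have h₂ : IsPullback (ρ_ X).inv f (f ▷ 𝟙_ V) (ρ_ Y).inv :=
    IsPullback.of_horiz_isIso ⟨(rightUnitor_inv_naturality f).symm⟩
  exact h₂.paste_horiz (h₁.paste_horiz (isPullback_act f))

/-- The stages of the chain, tensored on the right, are coproducts. -/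
noncomputable def chainSuccTensorIsColimit (X : V) (n : ℕ) (B : V) :
    IsColimit (BinaryCofan.mk (injOne X n ▷ B) (injAct X n ▷ B)) :=
  coprodTensorIsColimit (𝟙_ V) (X ⊗ chainObj X n) B

section Desc

variable {X X' B B' C C' : V} {f : X ⟶ X'} {g : B ⟶ B'} {k : C ⟶ C'} {b : B ⟶ C} {b' : B' ⟶ C'}
  {c : X ⊗ C ⟶ C} {c' : X' ⊗ C' ⟶ C'}

theorem isPullback_descStage (hb : IsPullback b g k b') (hc : IsPullback c (f ⊗ₘ k) k c') :
    ∀ n, IsPullback (descStage b c n) (stageMap f n ⊗ₘ g) k (descStage b' c' n)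
  | 0 => isPullback_of_isInitial (isInitialTensor initialIsInitial B)
      (isInitialTensor initialIsInitial B')
  | n + 1 => by
    refine isPullback_of_isColimit_binaryCofan (chainSuccTensorIsColimit X n B)
      (chainSuccTensorIsColimit X' n B') (f := 𝟙 _ ⊗ₘ g) (g := (f ⊗ₘ stageMap f n) ⊗ₘ g)
      ?_ ?_ ?_ ?_
    · rw [← tensorHom_id, ← tensorHom_id, tensorHom_comp_tensorHom, tensorHom_comp_tensorHom]
      simp
    · rw [← tensorHom_id, ← tensorHom_id, tensorHom_comp_tensorHom, tensorHom_comp_tensorHom]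
      simp
    · rw [injOne_descStage, injOne_descStage]
      exact IsPullback.paste_horiz (IsPullback.of_horiz_isIso ⟨by simp⟩) hb
    · rw [injAct_descStage, injAct_descStage]
      have hα : IsPullback (α_ X (chainObj X n) B).hom ((f ⊗ₘ stageMap f n) ⊗ₘ g)
          (f ⊗ₘ (stageMap f n ⊗ₘ g)) (α_ X' (chainObj X' n) B').hom :=
        IsPullback.of_horiz_isIso ⟨(associator_naturality _ _ _).symm⟩
      refine hα.paste_horiz (IsPullback.paste_horiz ?_ hc)
      have := tensor_isPullback (IsPullback.of_id_fst (f := f)) (isPullback_descStage hb hc n)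
      rwa [id_tensorHom, id_tensorHom] at this

theorem isPullback_desc (hb : IsPullback b g k b') (hc : IsPullback c (f ⊗ₘ k) k c') :
    IsPullback (desc b c) (freeMap f ⊗ₘ g) k (desc b' c') := by
  let α : tensorSeq (chain X) ((Functor.const ℕ).obj B) ⟶
      tensorSeq (chain X') ((Functor.const ℕ).obj B') :=
    { app := fun n => (chainNatTrans f).app n ⊗ₘ g
      naturality := fun m n t => by
        dsimp only [tensorSeq]
        rw [tensorHom_comp_tensorHom, tensorHom_comp_tensorHom, NatTrans.naturality]
        simp }
  refine isPullback_of_isColimit (IsNested.tensorSeq (isNested_chain X') (IsNested.const B'))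
    (freeTensorIsColimit X B) (freeTensorIsColimit X' B') α (fun n => ?_) fun n => ?_
  · change (incl X n ⊗ₘ 𝟙 B) ≫ (freeMap f ⊗ₘ g) = (stageMap f n ⊗ₘ g) ≫ (incl X' n ⊗ₘ 𝟙 B')
    rw [tensorHom_comp_tensorHom, tensorHom_comp_tensorHom, incl_freeMap, Category.id_comp,
      Category.comp_id]
  · have := isPullback_descStage hb hc n
    rw [← incl_desc, ← incl_desc, ← tensorHom_id, ← tensorHom_id] at this
    exact this

theorem isPullback_fold {b : 𝟙_ V ⟶ C} {b' : 𝟙_ V ⟶ C'} (hb : IsPullback b (𝟙 _) k b')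
    (hc : IsPullback c (f ⊗ₘ k) k c') :
    IsPullback (fold b c) (freeMap f) k (fold b' c') := by
  have := isPullback_desc hb hc
  rw [tensorHom_id] at this
  exact IsPullback.paste_horiz
    (IsPullback.of_horiz_isIso ⟨(rightUnitor_inv_naturality (freeMap f)).symm⟩) this

end Desc

theorem isPullback_mul {X Y : V} (f : X ⟶ Y) :
    IsPullback (mul X) (freeMap f ⊗ₘ freeMap f) (freeMap f) (mul Y) :=
  isPullback_desc IsPullback.of_id_fst (isPullback_act f)

theorem isPullback_lift_id {X Y : V} (f : X ⟶ Y) :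
    IsPullback (lift (𝟙 (freeObj X))) (freeMap (freeMap f)) (freeMap f)
      (lift (𝟙 (freeObj Y))) := by
  refine isPullback_fold (isPullback_one f) ?_
  rw [id_whiskerRight, id_whiskerRight, Category.id_comp, Category.id_comp]
  exact isPullback_mul f

section Pullback

variable {P X Y Z : V} {p : P ⟶ X} {q : P ⟶ Y} {f : X ⟶ Z} {g : Y ⟶ Z}

theorem isPullback_stageMap (h : IsPullback p q f g) :
    ∀ n, IsPullback (stageMap p n) (stageMap q n) (stageMap f n) (stageMap g n)
  | 0 => IsPullback.of_id_fst
  | n + 1 => isPullback_coprod_map IsPullback.of_id_fst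
      (tensor_isPullback h (isPullback_stageMap h n))

theorem map_chainNatTrans (f : X ⟶ Y) :
    (freeCoconeIsColimit X).map (freeCocone Y) (chainNatTrans f) = freeMap f :=
  (freeCoconeIsColimit X).hom_ext fun n => by
    rw [IsColimit.ι_map]
    exact (incl_freeMap f n).symm

theorem isPullback_freeMap (h : IsPullback p q f g) :
    IsPullback (freeMap p) (freeMap q) (freeMap f) (freeMap g) := by
  have key : IsPullback (chainNatTrans p) (chainNatTrans q) (chainNatTrans f)
    (chainNatTrans g) := IsPullback.of_forall_isPullback_app (isPullback_stageMap h)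
  have := SuitableCategory.nested_pullback (isNested_chain X) (isNested_chain Y)
    (isNested_chain Z) key (freeCoconeIsColimit P) (freeCoconeIsColimit X)
    (freeCoconeIsColimit Y) (freeCoconeIsColimit Z)
  simp only [map_chainNatTrans] at this
  exact this

end Pullback

theorem freeMap_eq {X Y : V} (f : X ⟶ Y) :
    (adj V).toMonad.toFunctor.map f = freeMap f := free_map_hom f

theorem isCartesianMonad_adj : IsCartesianMonad (adj V).toMonad where
  preserves_pullbacks := preservesPullbacks_of_isPullback _ fun h => by
    simpa only [freeMap_eq] using! isPullback_freeMap h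
  unit_isPullback f := by
    rw [freeMap_eq]
    simpa only [Adjunction.toMonad_η, adj_unit_app] using! isPullback_gen f
  mul_isPullback f := by
    rw [freeMap_eq, freeMap_eq]
    exact isPullback_lift_id f

section Nested

variable {X : ℕ ⥤ V} {c : Cocone X}

theorem isNested_free (hX : IsNested X) :
    IsNested (X ⋙ (adj V).toMonad.toFunctor) := fun _ _ f => by
  have := hX f
  have := (isCartesianMonad_adj (V := V)).preserves_pullbacks
  exact inferInstanceAs (Mono ((adj V).toMonad.toFunctor.map (X.map f)))

theorem nonempty_isColimit_free (hX : IsNested X) (hc : IsColimit c) :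
    Nonempty (IsColimit ((adj V).toMonad.toFunctor.mapCocone c)) := by
  have := SuitableCategory.hasColimit_nested _ (isNested_free hX)
  let L : V := colimit (X ⋙ (adj V).toMonad.toFunctor)
  let i : ∀ n, X.obj n ⟶ c.pt := fun n => c.ι.app n
  let d : ∀ n, freeObj (X.obj n) ⟶ L := colimit.ι (X ⋙ (adj V).toMonad.toFunctor)
  have d_w : ∀ {m n : ℕ} (f : m ⟶ n), freeMap (X.map f) ≫ d n = d m := fun f => by
    have := colimit.w (X ⋙ (adj V).toMonad.toFunctor) f
    rwa [Functor.comp_map, freeMap_eq] at this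
  have d_act : ∀ {m n : ℕ} (f : m ⟶ n), (X.map f ⊗ₘ freeMap (X.map f)) ≫ act (X.obj n) ≫ d n =
      act (X.obj m) ≫ d m := fun f => by
    rw [← d_w f, reassoc_of% @act_freeMap]
  obtain ⟨ht⟩ := nonempty_isColimit_tensorCocone hX (isNested_free hX) hc
    (colimit.isColimit (X ⋙ (adj V).toMonad.toFunctor))
  let s : Cocone (tensorSeq X (X ⋙ (adj V).toMonad.toFunctor)) :=
    { pt := L
      ι :=
        { app := fun n => act (X.obj n) ≫ d n
          naturality := fun m n f => by
            dsimp only [tensorSeq, Functor.comp_map]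
            rw [freeMap_eq]
            exact (d_act f).trans (Category.comp_id _).symm } }
  let cL : c.pt ⊗ L ⟶ L := ht.desc s
  have hcL : ∀ n, (i n ⊗ₘ d n) ≫ cL = act (X.obj n) ≫ d n := ht.fac s
  have hone : ∀ n, one (X.obj n) ≫ d n = one (X.obj 0) ≫ d 0 := fun n => by
    rw [← d_w (homOfLE (Nat.zero_le n)), reassoc_of% @one_freeMap]
  let φ : freeObj c.pt ⟶ L := fold (one (X.obj 0) ≫ d 0) cL
  let ψ : L ⟶ freeObj c.pt := (colimit.isColimit (X ⋙ (adj V).toMonad.toFunctor)).desc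
    ((adj V).toMonad.toFunctor.mapCocone c)
  have hψ : ∀ n, d n ≫ ψ = freeMap (i n) := fun n =>
    ((colimit.isColimit (X ⋙ (adj V).toMonad.toFunctor)).fac
      ((adj V).toMonad.toFunctor.mapCocone c) n).trans (freeMap_eq _)
  have hcψ : cL ≫ ψ = c.pt ◁ ψ ≫ act c.pt := ht.hom_ext fun n => by
    change (i n ⊗ₘ d n) ≫ _ = (i n ⊗ₘ d n) ≫ _
    rw [reassoc_of% hcL, hψ, act_freeMap, ← id_tensorHom, tensorHom_comp_tensorHom_assoc, hψ,
      Category.comp_id]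
  have hφψ : φ ≫ ψ = 𝟙 _ := by
    refine fold_hom_ext (b := one c.pt) (c := act c.pt) ?_ ?_ ?_ ?_
    · rw [reassoc_of% @one_fold, Category.assoc, hψ, one_freeMap]
    · rw [reassoc_of% @act_fold, hcψ, whiskerLeft_comp_assoc]
    · rw [Category.comp_id]
    · rw [Category.comp_id, whiskerLeft_id, Category.id_comp]
  have hψφ : ψ ≫ φ = 𝟙 _ := by
    refine colimit.hom_ext fun n => ?_
    change d n ≫ ψ ≫ φ = d n ≫ 𝟙 _
    rw [← Category.assoc, hψ, Category.comp_id]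
    refine fold_hom_ext (b := one (X.obj 0) ≫ d 0) (c := i n ▷ L ≫ cL) ?_ ?_ ?_ ?_
    · rw [reassoc_of% @one_freeMap, one_fold]
    · rw [reassoc_of% @act_freeMap, act_fold, MonoidalCategory.tensorHom_def', Category.assoc,
        ← whisker_exchange_assoc, ← whiskerLeft_comp_assoc]
    · exact hone n
    · rw [← hcL n, MonoidalCategory.tensorHom_def', Category.assoc]
  have : IsIso ((colimit.isColimit (X ⋙ (adj V).toMonad.toFunctor)).desc
    ((adj V).toMonad.toFunctor.mapCocone c)) := ⟨φ, hψφ, hφψ⟩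
  exact ⟨IsColimit.ofPointIso (colimit.isColimit (X ⋙ (adj V).toMonad.toFunctor))⟩

end Nested

theorem isSuitableMonad_adj : IsSuitableMonad (adj V).toMonad where
  toIsCartesianMonad := isCartesianMonad_adj
  preserves_nested _ hX := ⟨fun hc => nonempty_isColimit_free hX hc⟩

end FreeMonoid

namespace TGraph

section Arrow

variable {E : Type u} [Category.{v} E] (T : Monad E) (S : E)

/-- The functor sending a `T`-graph to its object of arrows. -/
def arrow : TGraph T S ⥤ E where
  obj X := X.arr
  map f := f.hom

variable [HasFiniteLimits E]

/-- A `T`-graph on `S` is an object over `T S ⨯ S`. -/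
noncomputable def toOver : TGraph T S ⥤ Over (T.obj S ⨯ S) where
  obj X := Over.mk (prod.lift X.dom X.cod)
  map f := Over.homMk f.hom (by
    ext
    · simp [f.hom_dom, prod.lift_fst]
    · simp [f.hom_cod, prod.lift_snd])

instance : (toOver T S).Faithful where
  map_injective h := Hom.ext (congrArg CommaMorphism.left h)

instance : (toOver T S).Full where
  map_surjective {X Y} g := ⟨⟨g.left, by simpa [toOver, prod.lift_fst] using Over.w g =≫ prod.fst,
    by simpa [toOver, prod.lift_snd] using Over.w g =≫ prod.snd⟩, rfl⟩

instance : (toOver T S).EssSurj where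
  mem_essImage Z := ⟨⟨Z.left, Z.hom ≫ prod.fst, Z.hom ≫ prod.snd⟩,
    ⟨Over.isoMk (Iso.refl _) (by
      ext
      · simp [toOver, prod.lift_fst]
      · simp [toOver, prod.lift_snd])⟩⟩

instance : (toOver T S).IsEquivalence where

noncomputable instance : CreatesColimitsOfSize.{0, 0} (arrow T S) :=
  inferInstanceAs (CreatesColimitsOfSize.{0, 0} (toOver T S ⋙ Over.forget _))

instance : PreservesLimitsOfShape WalkingCospan (arrow T S) :=
  inferInstanceAs (PreservesLimitsOfShape WalkingCospan (toOver T S ⋙ Over.forget _))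

noncomputable instance : CreatesLimitsOfShape WalkingCospan (arrow T S) :=
  inferInstanceAs (CreatesLimitsOfShape WalkingCospan (toOver T S ⋙ Over.forget _))

instance : HasFiniteLimits (TGraph T S) :=
  ⟨fun _ _ _ => Adjunction.hasLimitsOfShape_of_equivalence (toOver T S)⟩

end Arrow

section Suitable

variable {E : Type u} [Category.{v} E] [SuitableCategory E] (T : Monad E) (S : E)

instance (J : Type) [Finite J] : HasColimitsOfShape (Discrete J) (TGraph T S) :=
  hasColimitsOfShape_of_hasColimitsOfShape_createsColimitsOfShape (arrow T S)

instance : HasFiniteCoproducts (TGraph T S) := ⟨fun _ => inferInstance⟩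

variable {T S}

theorem mono_arrow_map {X Y : TGraph T S} (f : X ⟶ Y) [Mono f] : Mono f.hom :=
  inferInstanceAs (Mono ((arrow T S).map f))

theorem IsNested.comp_arrow {A : ℕ ⥤ TGraph T S} (hA : IsNested A) :
    IsNested (A ⋙ arrow T S) := fun _ _ f => by
  have := hA f
  exact mono_arrow_map (A.map f)

theorem preservesColimit_arrow {A : ℕ ⥤ TGraph T S} (hA : IsNested A) :
    PreservesColimit A (arrow T S) := by
  have := SuitableCategory.hasColimit_nested _ (IsNested.comp_arrow hA)
  infer_instance

theorem isPullback_of_arrow {P X Y Z : TGraph T S} {p : P ⟶ X} {q : P ⟶ Y} {f : X ⟶ Z}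
    {g : Y ⟶ Z} (h : IsPullback p.hom q.hom f.hom g.hom) : IsPullback p q f g :=
  IsPullback.of_map (arrow T S) (Hom.ext h.w) h

theorem isPullback_arrow {P X Y Z : TGraph T S} {p : P ⟶ X} {q : P ⟶ Y} {f : X ⟶ Z}
    {g : Y ⟶ Z} (h : IsPullback p q f g) : IsPullback p.hom q.hom f.hom g.hom :=
  h.map (arrow T S)

instance : SuitableCategory (TGraph T S) where
  hasFiniteLimits := inferInstance
  hasFiniteCoproducts := inferInstance
  mono_coproj D c hc i := by
    have : Mono ((arrow T S).map (c.ι.app i)) :=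
      SuitableCategory.mono_coproj _ _ (isColimitOfPreserves (arrow T S) hc) i
    exact (arrow T S).mono_of_mono_map this
  disjoint A B := by
    refine isPullback_of_arrow ?_
    have hc := mapIsColimitOfPreservesOfIsColimit (arrow T S) _ _ (coprodIsCoprod A B)
    have h₀ : IsInitial ((arrow T S).obj (⊥_ (TGraph T S))) :=
      initialIsInitial.isInitialObj (arrow T S)
    let e : A.arr ⨿ B.arr ≅ (A ⨿ B).arr := (coprodIsCoprod A.arr B.arr).coconePointUniqueUpToIso hc
    refine (SuitableCategory.disjoint A.arr B.arr).of_iso (initialIsInitial.uniqueUpToIso h₀)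
      (Iso.refl _) (Iso.refl _) e (initialIsInitial.hom_ext _ _) (initialIsInitial.hom_ext _ _) ?_ ?_
    · exact ((coprodIsCoprod A.arr B.arr).comp_coconePointUniqueUpToIso_hom hc
        ⟨WalkingPair.left⟩).trans (Category.id_comp _).symm
    · exact ((coprodIsCoprod A.arr B.arr).comp_coconePointUniqueUpToIso_hom hc
        ⟨WalkingPair.right⟩).trans (Category.id_comp _).symm
  stable D c hc :=
    IsUniversalColimit.of_mapCocone (arrow T S)
      (SuitableCategory.stable _ _ (isColimitOfPreserves (arrow T S) hc))
  hasColimit_nested A hA := by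
    have := SuitableCategory.hasColimit_nested _ (IsNested.comp_arrow hA)
    exact hasColimit_of_created A (arrow T S)
  nested_pullback {P A B C p q f g} hA hB hC h cP cA cB cC hP hcA hcB hcC := by
    have hP' : IsNested P := fun m n t => by
      have := hA t
      have := hB t
      refine ⟨fun u v huv => (h.app m).hom_ext ?_ ?_⟩
      · rw [← cancel_mono (A.map t), Category.assoc, Category.assoc, ← p.naturality,
          reassoc_of% huv]
      · rw [← cancel_mono (B.map t), Category.assoc, Category.assoc, ← q.naturality,
          reassoc_of% huv]
    have := preservesColimit_arrow hP'
    have := preservesColimit_arrow hA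
    have := preservesColimit_arrow hB
    have := preservesColimit_arrow hC
    have key : IsPullback (Functor.whiskerRight p (arrow T S))
        (Functor.whiskerRight q (arrow T S)) (Functor.whiskerRight f (arrow T S))
        (Functor.whiskerRight g (arrow T S)) :=
      IsPullback.of_forall_isPullback_app fun n => isPullback_arrow (h.app n)
    refine isPullback_of_arrow ?_
    have := SuitableCategory.nested_pullback (IsNested.comp_arrow hA) (IsNested.comp_arrow hB)
      (IsNested.comp_arrow hC) key (isColimitOfPreserves (arrow T S) hP)
      (isColimitOfPreserves (arrow T S) hcA) (isColimitOfPreserves (arrow T S) hcB)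
      (isColimitOfPreserves (arrow T S) hcC)
    have e : ∀ {A B : ℕ ⥤ TGraph T S} [PreservesColimit A (arrow T S)] {c : Cocone A}
        {d : Cocone B} (hc : IsColimit c) (α : A ⟶ B),
        (isColimitOfPreserves (arrow T S) hc).map ((arrow T S).mapCocone d)
          (Functor.whiskerRight α (arrow T S)) = (hc.map d α).hom := fun {A B _ c d} hc α =>
      (isColimitOfPreserves (arrow T S) hc).hom_ext fun n => by
        rw [IsColimit.ι_map]
        exact ((arrow T S).congr_map (hc.ι_map d α n)).symm
    simp only [e] at this
    exact this
  nested_mono_coproj A hA c hc n := by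
    have := preservesColimit_arrow hA
    have : Mono ((arrow T S).map (c.ι.app n)) := SuitableCategory.nested_mono_coproj _
      (IsNested.comp_arrow hA) _ (isColimitOfPreserves (arrow T S) hc) n
    exact (arrow T S).mono_of_mono_map this

end Suitable

end TGraph

namespace TGraph

section Projections

variable {E : Type u} [Category.{v} E] {T : Monad E} {S : E}

@[simp]
theorem id_hom (X : TGraph T S) : Hom.hom (𝟙 X) = 𝟙 X.arr := rfl

variable [HasPullbacks E]

@[simp]
theorem tensorMap_hom_fst {X X' Y Y' : TGraph T S} (f : X ⟶ X') (g : Y ⟶ Y') :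
    (tensorMap f g).hom ≫ fst X' Y' = fst X Y ≫ f.hom := lift_fst _ _ _

@[simp]
theorem tensorMap_hom_fst_assoc {X X' Y Y' : TGraph T S} (f : X ⟶ X') (g : Y ⟶ Y') {W : E}
    (h : X'.arr ⟶ W) : (tensorMap f g).hom ≫ fst X' Y' ≫ h = fst X Y ≫ f.hom ≫ h := by
  rw [reassoc_of% @tensorMap_hom_fst]

@[simp]
theorem tensorMap_hom_snd {X X' Y Y' : TGraph T S} (f : X ⟶ X') (g : Y ⟶ Y') :
    (tensorMap f g).hom ≫ snd X' Y' = snd X Y ≫ T.map g.hom := lift_snd _ _ _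

@[simp]
theorem tensorMap_hom_snd_assoc {X X' Y Y' : TGraph T S} (f : X ⟶ X') (g : Y ⟶ Y') {W : E}
    (h : T.obj Y'.arr ⟶ W) :
    (tensorMap f g).hom ≫ snd X' Y' ≫ h = snd X Y ≫ T.map g.hom ≫ h := by
  rw [reassoc_of% @tensorMap_hom_snd]

@[simp]
theorem assoc_hom_fst_fst (X Y Z : TGraph T S) :
    (assoc X Y Z).hom ≫ fst (tensor X Y) Z ≫ fst X Y = fst X (tensor Y Z) := by
  rw [assoc, reassoc_of% @lift_fst]
  exact lift_fst _ _ _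

@[simp]
theorem assoc_hom_fst_fst_assoc (X Y Z : TGraph T S) {W : E} (h : X.arr ⟶ W) :
    (assoc X Y Z).hom ≫ fst (tensor X Y) Z ≫ fst X Y ≫ h = fst X (tensor Y Z) ≫ h := by
  rw [reassoc_of% @assoc_hom_fst_fst]

@[simp]
theorem assoc_hom_fst_snd (X Y Z : TGraph T S) :
    (assoc X Y Z).hom ≫ fst (tensor X Y) Z ≫ snd X Y =
      snd X (tensor Y Z) ≫ T.map (fst Y Z) := by
  rw [assoc, reassoc_of% @lift_fst]
  exact lift_snd _ _ _

@[simp]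
theorem assoc_hom_fst_snd_assoc (X Y Z : TGraph T S) {W : E} (h : T.obj Y.arr ⟶ W) :
    (assoc X Y Z).hom ≫ fst (tensor X Y) Z ≫ snd X Y ≫ h =
      snd X (tensor Y Z) ≫ T.map (fst Y Z) ≫ h := by
  rw [reassoc_of% @assoc_hom_fst_snd]

@[simp]
theorem assoc_hom_snd (X Y Z : TGraph T S) : (assoc X Y Z).hom ≫ snd (tensor X Y) Z =
    snd X (tensor Y Z) ≫ T.map (snd Y Z) ≫ T.μ.app Z.arr := lift_snd _ _ _

@[simp]
theorem assoc_hom_snd_assoc (X Y Z : TGraph T S) {W : E} (h : T.obj Z.arr ⟶ W) :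
    (assoc X Y Z).hom ≫ snd (tensor X Y) Z ≫ h =
      snd X (tensor Y Z) ≫ T.map (snd Y Z) ≫ T.μ.app Z.arr ≫ h := by
  rw [reassoc_of% @assoc_hom_snd]

@[simp]
theorem leftUnit_hom_fst (X : TGraph T S) : (leftUnit X).hom ≫ fst (unit T S) X = X.cod :=
  lift_fst _ _ _

@[simp]
theorem leftUnit_hom_snd (X : TGraph T S) :
    (leftUnit X).hom ≫ snd (unit T S) X = T.η.app X.arr :=
  lift_snd _ _ _

@[simp]
theorem rightUnit_hom_fst (X : TGraph T S) : (rightUnit X).hom ≫ fst X (unit T S) = 𝟙 X.arr :=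
  lift_fst _ _ _

@[simp]
theorem rightUnit_hom_snd (X : TGraph T S) : (rightUnit X).hom ≫ snd X (unit T S) = X.dom :=
  lift_snd _ _ _

theorem hom_ext_tensor {W X Y : TGraph T S} {f g : W ⟶ tensor X Y}
    (h₁ : f.hom ≫ fst X Y = g.hom ≫ fst X Y) (h₂ : f.hom ≫ snd X Y = g.hom ≫ snd X Y) : f = g :=
  Hom.ext (tensor_hom_ext h₁ h₂)

theorem hom_ext_tensor₃ {W X Y Z : TGraph T S} {f g : W ⟶ tensor (tensor X Y) Z}
    (h₁ : f.hom ≫ fst (tensor X Y) Z ≫ fst X Y = g.hom ≫ fst (tensor X Y) Z ≫ fst X Y)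
    (h₂ : f.hom ≫ fst (tensor X Y) Z ≫ snd X Y = g.hom ≫ fst (tensor X Y) Z ≫ snd X Y)
    (h₃ : f.hom ≫ snd (tensor X Y) Z = g.hom ≫ snd (tensor X Y) Z) : f = g :=
  hom_ext_tensor (tensor_hom_ext (by simpa using h₁) (by simpa using h₂)) h₃

theorem assoc_naturality {X X' Y Y' Z Z' : TGraph T S} (f : X ⟶ X') (g : Y ⟶ Y') (h : Z ⟶ Z') :
    assoc X Y Z ≫ tensorMap (tensorMap f g) h =
      tensorMap f (tensorMap g h) ≫ assoc X' Y' Z' := by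
  have h₁ := congrArg T.map (tensorMap_hom_fst g h)
  have h₂ := congrArg T.map (tensorMap_hom_snd g h)
  simp only [T.map_comp] at h₁ h₂
  refine hom_ext_tensor₃ ?_ ?_ ?_
  · simp [comp_hom]
  · simp [comp_hom, h₁]
  · simp [comp_hom, reassoc_of% h₂, T.mu_naturality]

theorem leftUnit_naturality {X Y : TGraph T S} (f : X ⟶ Y) :
    leftUnit X ≫ tensorMap (𝟙 (unit T S)) f = f ≫ leftUnit Y := by
  refine hom_ext_tensor ?_ ?_
  · simp [comp_hom, f.hom_cod]
  · simpa [comp_hom, reassoc_of% @leftUnit_hom_snd] using (T.η.naturality f.hom).symm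

theorem rightUnit_naturality {X Y : TGraph T S} (f : X ⟶ Y) :
    rightUnit X ≫ tensorMap f (𝟙 (unit T S)) = f ≫ rightUnit Y := by
  refine hom_ext_tensor ?_ ?_
  · simp [comp_hom, reassoc_of% @rightUnit_hom_fst]
  · simp [comp_hom, f.hom_dom]

theorem pentagon (W X Y Z : TGraph T S) :
    tensorMap (𝟙 W) (assoc X Y Z) ≫ assoc W (tensor X Y) Z ≫ tensorMap (assoc W X Y) (𝟙 Z) =
      assoc W X (tensor Y Z) ≫ assoc (tensor W X) Y Z := by
  have h₁ := congrArg T.map (assoc_hom_fst_fst X Y Z)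
  have h₂ := congrArg T.map (assoc_hom_fst_snd X Y Z)
  have h₃ := congrArg T.map (assoc_hom_snd X Y Z)
  simp only [T.map_comp] at h₁ h₂ h₃
  refine hom_ext_tensor₃ (tensor_hom_ext ?_ ?_) ?_ ?_
  · simp [comp_hom]
  · simp [comp_hom, h₁]
  · simp [comp_hom, reassoc_of% h₂, T.mu_naturality]
  · simp [comp_hom, reassoc_of% h₃, T.assoc, T.mu_naturality_assoc]

theorem triangle (X Y : TGraph T S) :
    tensorMap (𝟙 X) (leftUnit Y) ≫ assoc X (unit T S) Y = tensorMap (rightUnit X) (𝟙 Y) := by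
  have h₁ := congrArg T.map (leftUnit_hom_fst Y)
  have h₂ := congrArg T.map (leftUnit_hom_snd Y)
  simp only [T.map_comp] at h₁ h₂
  refine hom_ext_tensor₃ ?_ ?_ ?_
  · simp [comp_hom]
  · simp [comp_hom, h₁, condition]
  · simp [comp_hom, reassoc_of% h₂]

end Projections

section Iso

variable {E : Type u} [Category.{v} E] [HasPullbacks E] {T : Monad E} {S : E}

/-- An isomorphism of `T`-graphs from an isomorphism of objects of arrows. -/
def isoMk {X Y : TGraph T S} (f : X ⟶ Y) (g : Y.arr ⟶ X.arr) (h : f.hom ≫ g = 𝟙 X.arr)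
    (h' : g ≫ f.hom = 𝟙 Y.arr) : X ≅ Y where
  hom := f
  inv := ⟨g, by rw [← f.hom_dom, reassoc_of% h'], by rw [← f.hom_cod, reassoc_of% h']⟩
  hom_inv_id := Hom.ext h
  inv_hom_id := Hom.ext h'

theorem rightUnit_isIso (X : TGraph T S) : IsIso (rightUnit X) :=
  (isoMk (rightUnit X) (fst X (unit T S)) (rightUnit_hom_fst X) (tensor_hom_ext
    (by simp) (by simp [condition]))).isIso_hom

theorem leftUnit_isIso (hT : IsCartesianMonad T) (X : TGraph T S) : IsIso (leftUnit X) := by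
  have h := hT.unit_isPullback X.cod
  refine (isoMk (leftUnit X) (h.lift (snd (unit T S) X) (fst (unit T S) X)
    (condition (unit T S) X).symm) (h.hom_ext ?_ ?_) (tensor_hom_ext ?_ ?_)).isIso_hom
  all_goals simp

theorem assoc_isIso (hT : IsCartesianMonad T) (X Y Z : TGraph T S) : IsIso (assoc X Y Z) := by
  have := hT.preserves_pullbacks
  have h := hT.mul_isPullback Z.cod
  have hYZ : IsPullback (T.map (fst Y Z)) (T.map (snd Y Z)) (T.map Y.dom)
    (T.map (T.map Z.cod)) := (IsPullback.of_hasPullback Y.dom (T.map Z.cod)).map T.toFunctor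
  have w : fst (tensor X Y) Z ≫ snd X Y ≫ T.map Y.dom ≫ T.μ.app S =
      snd (tensor X Y) Z ≫ T.map Z.cod := condition (tensor X Y) Z
  let z : (tensor (tensor X Y) Z).arr ⟶ T.obj (T.obj Z.arr) :=
    h.lift (snd (tensor X Y) Z) (fst (tensor X Y) Z ≫ snd X Y ≫ T.map Y.dom)
      (by simpa using w.symm)
  have hz₁ : z ≫ T.μ.app Z.arr = snd (tensor X Y) Z := h.lift_fst _ _ _
  have hz₂ : z ≫ T.map (T.map Z.cod) = fst (tensor X Y) Z ≫ snd X Y ≫ T.map Y.dom :=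
    h.lift_snd _ _ _
  let y : (tensor (tensor X Y) Z).arr ⟶ T.obj (tensor Y Z).arr :=
    hYZ.lift (fst (tensor X Y) Z ≫ snd X Y) z (by simp [hz₂])
  have hy₁ : y ≫ T.map (fst Y Z) = fst (tensor X Y) Z ≫ snd X Y := hYZ.lift_fst _ _ _
  have hy₂ : y ≫ T.map (snd Y Z) = z := hYZ.lift_snd _ _ _
  let l : (tensor (tensor X Y) Z).arr ⟶ (tensor X (tensor Y Z)).arr :=
    lift (fst (tensor X Y) Z ≫ fst X Y) y (by
      rw [tensor_cod, T.map_comp, reassoc_of% hy₁, Category.assoc, condition])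
  have hl₁ : l ≫ fst X (tensor Y Z) = fst (tensor X Y) Z ≫ fst X Y := lift_fst _ _ _
  have hl₂ : l ≫ snd X (tensor Y Z) = y := lift_snd _ _ _
  refine (isoMk (assoc X Y Z) l (tensor_hom_ext ?_ (hYZ.hom_ext ?_ (h.hom_ext ?_ ?_)))
    (tensor_hom_ext (tensor_hom_ext ?_ ?_) ?_)).isIso_hom
  · simp [hl₁]
  · simp [reassoc_of% hl₂, hy₁]
  · simp [reassoc_of% hl₂, reassoc_of% hy₂, hz₁]
  · have hc := congrArg T.map (condition Y Z)
    simp only [T.map_comp] at hc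
    simp [reassoc_of% hl₂, reassoc_of% hy₂, hz₂, hc]
  · simp [hl₁]
  · simp [reassoc_of% hl₂, hy₁]
  · simp [reassoc_of% hl₂, reassoc_of% hy₂, hz₁]

end Iso

section Monoidal

variable {E : Type u} [Category.{v} E] [SuitableCategory E] {T : Monad E} {S : E}
  [hT : Fact (IsSuitableMonad T)]

open MonoidalCategory

/-- The unit isomorphism `X ≅ 1 ∘ X`. -/
noncomputable def leftUnitIso (X : TGraph T S) : X ≅ tensor (unit T S) X :=
  have := leftUnit_isIso hT.out.toIsCartesianMonad X
  asIso (leftUnit X)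

/-- The unit isomorphism `X ≅ X ∘ 1`. -/
noncomputable def rightUnitIso (X : TGraph T S) : X ≅ tensor X (unit T S) :=
  have := rightUnit_isIso X
  asIso (rightUnit X)

/-- The associativity isomorphism `X ∘ (Y ∘ Z) ≅ (X ∘ Y) ∘ Z`. -/
noncomputable def assocIso (X Y Z : TGraph T S) :
    tensor X (tensor Y Z) ≅ tensor (tensor X Y) Z :=
  have := assoc_isIso hT.out.toIsCartesianMonad X Y Z
  asIso (assoc X Y Z)

/-- The composite of isomorphisms of spans. -/
noncomputable def tensorIso {X X' Y Y' : TGraph T S} (e : X ≅ X') (f : Y ≅ Y') :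
    tensor X Y ≅ tensor X' Y' where
  hom := tensorMap e.hom f.hom
  inv := tensorMap e.inv f.inv
  hom_inv_id := by rw [← tensorMap_comp, e.hom_inv_id, f.hom_inv_id, tensorMap_id]
  inv_hom_id := by rw [← tensorMap_comp, e.inv_hom_id, f.inv_hom_id, tensorMap_id]

noncomputable instance : MonoidalCategoryStruct (TGraph T S) where
  tensorObj := tensor
  tensorUnit := unit T S
  tensorHom := tensorMap
  whiskerLeft X _ _ f := tensorMap (𝟙 X) f
  whiskerRight f Y := tensorMap f (𝟙 Y)
  associator X Y Z := (assocIso X Y Z).symm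
  leftUnitor X := (leftUnitIso X).symm
  rightUnitor X := (rightUnitIso X).symm

noncomputable instance : MonoidalCategory (TGraph T S) :=
  .ofTensorHom
    (id_tensorHom_id := tensorMap_id)
    (id_tensorHom := fun _ _ _ _ => rfl)
    (tensorHom_id := fun _ _ => rfl)
    (tensorHom_comp_tensorHom := fun f g h k => (tensorMap_comp f h g k).symm)
    (associator_naturality := fun f g h => by
      refine (Iso.comp_inv_eq (assocIso _ _ _)).2 ((Category.assoc _ _ _).trans
        ((Iso.eq_inv_comp (assocIso _ _ _)).2 (assoc_naturality f g h)).symm).symm)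
    (leftUnitor_naturality := fun f => by
      refine (Iso.comp_inv_eq (leftUnitIso _)).2 ((Category.assoc _ _ _).trans
        ((Iso.eq_inv_comp (leftUnitIso _)).2 (leftUnit_naturality f)).symm).symm)
    (rightUnitor_naturality := fun f => by
      refine (Iso.comp_inv_eq (rightUnitIso _)).2 ((Category.assoc _ _ _).trans
        ((Iso.eq_inv_comp (rightUnitIso _)).2 (rightUnit_naturality f)).symm).symm)
    (pentagon := fun W X Y Z => by
      have := (Iso.inv_eq_inv (tensorIso (Iso.refl W) (assocIso X Y Z) ≪≫
        assocIso W (tensor X Y) Z ≪≫ tensorIso (assocIso W X Y) (Iso.refl Z))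
        (assocIso W X (tensor Y Z) ≪≫ assocIso (tensor W X) Y Z)).2 (pentagon W X Y Z)
      exact (Category.assoc _ _ _).symm.trans this)
    (triangle := fun X Y => by
      have := (Iso.inv_eq_inv (tensorIso (Iso.refl X) (leftUnitIso Y) ≪≫
        assocIso X (unit T S) Y) (tensorIso (rightUnitIso X) (Iso.refl Y))).2 (triangle X Y)
      exact this)

end Monoidal

end TGraph

namespace TGraph

open MonoidalCategory

variable {E : Type u} [Category.{v} E] [SuitableCategory E] {T : Monad E} {S : E}

theorem isPullback_fst_snd (X Y : TGraph T S) :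
    IsPullback (fst X Y) (snd X Y) X.dom (T.map Y.cod) :=
  IsPullback.of_hasPullback _ _

theorem isPullback_tensorMap (hT : IsCartesianMonad T) {P X Y Z P' X' Y' Z' : TGraph T S}
    {p : P ⟶ X} {q : P ⟶ Y} {f : X ⟶ Z} {g : Y ⟶ Z} {p' : P' ⟶ X'} {q' : P' ⟶ Y'}
    {f' : X' ⟶ Z'} {g' : Y' ⟶ Z'} (h : IsPullback p q f g) (h' : IsPullback p' q' f' g') :
    IsPullback (tensorMap p p') (tensorMap q q') (tensorMap f f') (tensorMap g g') := by
  have := hT.preserves_pullbacks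
  have k := isPullback_arrow h
  have k' : IsPullback (T.map p'.hom) (T.map q'.hom) (T.map f'.hom) (T.map g'.hom) :=
    (isPullback_arrow h').map T.toFunctor
  refine isPullback_of_arrow ⟨⟨?_⟩, ⟨PullbackCone.IsLimit.mk _ (fun s => lift
    (k.lift (s.fst ≫ fst X X') (s.snd ≫ fst Y Y') ?_)
    (k'.lift (s.fst ≫ snd X X') (s.snd ≫ snd Y Y') ?_) ?_) (fun s => ?_) (fun s => ?_)
    fun s m hm₁ hm₂ => ?_⟩⟩
  · rw [← comp_hom, ← comp_hom, ← tensorMap_comp, ← tensorMap_comp, h.w, h'.w]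
  · simpa using s.condition =≫ fst Z Z'
  · simpa using s.condition =≫ snd Z Z'
  · rw [← p.hom_dom, ← p'.hom_cod, k.lift_fst_assoc, T.map_comp, k'.lift_fst_assoc,
      Category.assoc, Category.assoc, condition]
  · refine tensor_hom_ext ?_ ?_
    · simp [reassoc_of% @lift_fst]
    · simp [reassoc_of% @lift_snd]
  · refine tensor_hom_ext ?_ ?_
    · simp [reassoc_of% @lift_fst]
    · simp [reassoc_of% @lift_snd]
  · refine tensor_hom_ext ?_ ?_
    · rw [lift_fst]
      refine k.hom_ext ?_ ?_
      · simp [← hm₁]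
      · simp [← hm₂]
    · rw [lift_snd]
      refine k'.hom_ext ?_ ?_
      · simp [← hm₁]
      · simp [← hm₂]

theorem mono_tensorMap (hT : IsCartesianMonad T) {X X' Y Y' : TGraph T S} (f : X ⟶ X')
    (g : Y ⟶ Y') [Mono f] [Mono g] : Mono (tensorMap f g) := by
  rw [mono_iff_isPullback]
  have := isPullback_tensorMap hT ((mono_iff_isPullback f).1 inferInstance)
    ((mono_iff_isPullback g).1 inferInstance)
  rwa [tensorMap_id] at this

theorem isPullback_tensorMap_id_fst {X X' : TGraph T S} (f : X ⟶ X') (B : TGraph T S) :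
    IsPullback (tensorMap f (𝟙 B)).hom (fst X B) (fst X' B) f.hom := by
  refine IsPullback.of_right (h₁₂ := snd X' B) (h₂₂ := X'.dom) (v₁₃ := T.map B.cod) ?_
    (tensorMap_hom_fst _ _) (isPullback_fst_snd X' B).flip
  rw [f.hom_dom, tensorMap_hom_snd, id_hom, T.map_id, Category.comp_id]
  exact (isPullback_fst_snd X B).flip

section

variable [hT : Fact (IsSuitableMonad T)]

theorem tensorRight_preservesFiniteCoproducts (B : TGraph T S) :
    PreservesFiniteCoproducts (tensorRight B) :=
  ⟨fun n => ⟨fun {K} => ⟨fun {c} hc => by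
    obtain ⟨h⟩ := SuitableCategory.stable _ _ (isColimitOfPreserves (arrow T S) hc)
      ((arrow T S).mapCocone ((tensorRight B).mapCocone c))
      { app := fun j => fst (K.obj j) B
        naturality := fun i j t => tensorMap_hom_fst (K.map t) (𝟙 B) }
      (fst c.pt B) (by
        ext j
        exact (tensorMap_hom_fst (c.ι.app j) (𝟙 B)).symm) (.of_discrete _)
      fun j => isPullback_tensorMap_id_fst (c.ι.app j) B
    exact ⟨isColimitOfReflects (arrow T S) h⟩⟩⟩⟩

theorem nonempty_isColimit_tensorCocone {F G : ℕ ⥤ TGraph T S} (hF : IsNested F)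
    (hG : IsNested G) {c : Cocone F} {d : Cocone G} (hc : IsColimit c) (hd : IsColimit d) :
    Nonempty (IsColimit (tensorCocone c d)) := by
  have := preservesColimit_arrow hF
  have := preservesColimit_arrow hG
  have hG' := IsNested.comp_arrow hG
  have := hT.out.preserves_nested _ hG'
  have := hT.out.preserves_pullbacks
  have hR : IsNested (tensorSeq F G ⋙ arrow T S) := IsNested.comp_arrow fun m n t => by
    have := hF t
    have := hG t
    exact mono_tensorMap hT.out.toIsCartesianMonad (F.map t) (G.map t)
  have hTG : IsNested ((G ⋙ arrow T S) ⋙ T.toFunctor) := fun m n t => by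
    have := hG' t
    exact inferInstanceAs (Mono (T.map ((G ⋙ arrow T S).map t)))
  have := SuitableCategory.hasColimit_nested _ hR
  have hP := colimit.isColimit (tensorSeq F G ⋙ arrow T S)
  have hA := isColimitOfPreserves (arrow T S) hc
  have hB := isColimitOfPreserves T.toFunctor (isColimitOfPreserves (arrow T S) hd)
  let p : tensorSeq F G ⋙ arrow T S ⟶ F ⋙ arrow T S :=
    { app := fun n => fst (F.obj n) (G.obj n)
      naturality := fun m n t => tensorMap_hom_fst (F.map t) (G.map t) }
  let q : tensorSeq F G ⋙ arrow T S ⟶ (G ⋙ arrow T S) ⋙ T.toFunctor :=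
    { app := fun n => snd (F.obj n) (G.obj n)
      naturality := fun m n t => tensorMap_hom_snd (F.map t) (G.map t) }
  let f : F ⋙ arrow T S ⟶ (Functor.const ℕ).obj (T.obj S) :=
    { app := fun n => (F.obj n).dom
      naturality := fun m n t => (F.map t).hom_dom.trans (Category.comp_id _).symm }
  let g : (G ⋙ arrow T S) ⋙ T.toFunctor ⟶ (Functor.const ℕ).obj (T.obj S) :=
    { app := fun n => T.map (G.obj n).cod
      naturality := fun m n t => ((T.map_comp _ _).symm.trans
        (congrArg T.map (G.map t).hom_cod)).trans (Category.comp_id _).symm }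
  have key : IsPullback p q f g :=
    IsPullback.of_forall_isPullback_app fun n => isPullback_fst_snd (F.obj n) (G.obj n)
  have h₁ := SuitableCategory.nested_pullback (IsNested.comp_arrow hF) hTG
    (IsNested.const (T.obj S)) key hP hA hB (constIsColimit (T.obj S))
  have hf : hA.map (Cocone.mk _ (𝟙 ((Functor.const ℕ).obj (T.obj S)))) f = c.pt.dom :=
    hA.hom_ext fun n => by
      rw [IsColimit.ι_map]
      exact (Category.comp_id _).trans (c.ι.app n).hom_dom.symm
  have hg : hB.map (Cocone.mk _ (𝟙 ((Functor.const ℕ).obj (T.obj S)))) g = T.map d.pt.cod :=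
    hB.hom_ext fun n => by
      rw [IsColimit.ι_map]
      exact (Category.comp_id _).trans ((congrArg T.map (d.ι.app n).hom_cod.symm).trans
        (T.map_comp _ _))
  rw [hf, hg] at h₁
  let e := h₁.isoIsPullback _ _ (isPullback_fst_snd c.pt d.pt)
  have he : hP.desc ((arrow T S).mapCocone (tensorCocone c d)) = e.hom := by
    refine hP.hom_ext fun n => ?_
    rw [hP.fac]
    refine tensor_hom_ext ?_ ?_
    · exact (tensorMap_hom_fst (c.ι.app n) (d.ι.app n)).trans (((hP.ι_map _ p n).symm.trans
        (congrArg (_ ≫ ·) (h₁.isoIsPullback_hom_fst _ _ _).symm)).trans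
          (Category.assoc _ _ _).symm)
    · exact (tensorMap_hom_snd (c.ι.app n) (d.ι.app n)).trans (((hP.ι_map _ q n).symm.trans
        (congrArg (_ ≫ ·) (h₁.isoIsPullback_hom_snd _ _ _).symm)).trans
          (Category.assoc _ _ _).symm)
  have : IsIso (hP.desc ((arrow T S).mapCocone (tensorCocone c d))) := by
    rw [he]
    exact e.isIso_hom
  exact ⟨isColimitOfReflects (arrow T S) (IsColimit.ofPointIso hP)⟩

instance : SuitableMonoidal (TGraph T S) where
  tensor_isPullback := isPullback_tensorMap hT.out.toIsCartesianMonad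
  preservesFiniteCoproducts_tensorRight := tensorRight_preservesFiniteCoproducts
  nonempty_isColimit_tensorCocone := nonempty_isColimit_tensorCocone

end

end TGraph

namespace TMulticategory

open MonoidalCategory TGraph

section Mon

variable {E : Type u} [Category.{v} E] [SuitableCategory E] {T : Monad E} {S : E}
  [hT : Fact (IsSuitableMonad T)]

/-- The `T`-multicategory underlying a monoid in the monoidal category of `T`-graphs. -/
noncomputable abbrev ofMon (M : Mon (TGraph T S)) : TMulticategory T S where
  graph := M.X
  comp := MonObj.mul (X := M.X)
  ids := MonObj.one (X := M.X)
  assoc' := (Iso.eq_inv_comp (α_ M.X M.X M.X)).2 (MonObj.mul_assoc M.X).symm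
  ids_comp := ((Iso.inv_comp_eq (λ_ M.X)).2
    ((MonObj.one_mul M.X).trans (Category.comp_id _).symm))
  comp_ids := ((Iso.inv_comp_eq (ρ_ M.X)).2
    ((MonObj.mul_one M.X).trans (Category.comp_id _).symm))

/-- The monoid structure on the `T`-graph underlying a `T`-multicategory. -/
noncomputable abbrev monObj (C : TMulticategory T S) : MonObj C.graph where
  one := C.ids
  mul := C.comp
  one_mul := ((Iso.inv_comp_eq (λ_ C.graph)).1 C.ids_comp).trans (Category.comp_id _)
  mul_one := ((Iso.inv_comp_eq (ρ_ C.graph)).1 C.comp_ids).trans (Category.comp_id _)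
  mul_assoc := ((Iso.eq_inv_comp (α_ C.graph C.graph C.graph)).1 C.assoc').symm

/-- The monoid in the monoidal category of `T`-graphs given by a `T`-multicategory. -/
noncomputable abbrev toMon (C : TMulticategory T S) : Mon (TGraph T S) where
  X := C.graph
  mon := monObj C

variable (T S) in
/-- The functor sending a monoid in the category of `T`-graphs to its `T`-multicategory. -/
noncomputable def ofMonFunctor : Mon (TGraph T S) ⥤ TMulticategory T S where
  obj := ofMon
  map f := ⟨f.hom, IsMonHom.mul_hom f.hom, IsMonHom.one_hom f.hom⟩

variable (T S) in
/-- The functor sending a `T`-multicategory to its monoid in the category of `T`-graphs. -/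
noncomputable def toMonFunctor : TMulticategory T S ⥤ Mon (TGraph T S) where
  obj := toMon
  map {C D} f := @Mon.Hom.mk _ _ _ (toMon C) (toMon D) f.graphHom
    (@IsMonHom.mk _ _ _ _ _ (monObj C) (monObj D) _ f.map_ids f.map_comp)

variable (T S) in
/-- The free `T`-multicategory functor. -/
noncomputable def free : TGraph T S ⥤ TMulticategory T S := FreeMonoid.free ⋙ ofMonFunctor T S

variable (T S) in
/-- The free `T`-multicategory functor is left adjoint to the forgetful functor. -/
noncomputable def adj : free T S ⊣ forget T S where
  unit := (FreeMonoid.adj (TGraph T S)).unit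
  counit :=
    { app := fun C =>
        (ofMonFunctor T S).map ((FreeMonoid.adj (TGraph T S)).counit.app (toMon C))
      naturality := fun _ _ f => congrArg (ofMonFunctor T S).map
        ((FreeMonoid.adj (TGraph T S)).counit.naturality ((toMonFunctor T S).map f)) }
  left_triangle_components X := congrArg (ofMonFunctor T S).map
    ((FreeMonoid.adj (TGraph T S)).left_triangle_components X)
  right_triangle_components C :=
    (FreeMonoid.adj (TGraph T S)).right_triangle_components (toMon C)

theorem isSuitableMonad_adj : IsSuitableMonad (adj T S).toMonad where
  preserves_pullbacks :=
    (FreeMonoid.isSuitableMonad_adj (V := TGraph T S)).preserves_pullbacks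
  unit_isPullback := (FreeMonoid.isSuitableMonad_adj (V := TGraph T S)).unit_isPullback
  mul_isPullback := (FreeMonoid.isSuitableMonad_adj (V := TGraph T S)).mul_isPullback
  preserves_nested := (FreeMonoid.isSuitableMonad_adj (V := TGraph T S)).preserves_nested

end Mon

section Monadic

variable {E : Type u} [Category.{v} E] [HasPullbacks E] {T : Monad E} {S : E}

instance : (forget T S).ReflectsIsomorphisms where
  reflects {C D} f hf := by
    have hf' : IsIso f.graphHom := hf
    refine ⟨⟨inv f.graphHom, ?_, ?_⟩, ?_, ?_⟩
    · rw [IsIso.comp_inv_eq, Category.assoc, f.map_comp, ← Category.assoc, ← tensorMap_comp,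
        IsIso.inv_hom_id, tensorMap_id, Category.id_comp]
    · rw [IsIso.comp_inv_eq, f.map_ids]
    · exact Hom.ext (IsIso.hom_inv_id f.graphHom)
    · exact Hom.ext (IsIso.inv_hom_id f.graphHom)

section Quotient

variable {C : TMulticategory T S} {Q : TGraph T S} {q : C.graph ⟶ Q} {s : Q ⟶ C.graph}

theorem id_tensorMap_quotient (hs : s ≫ q = 𝟙 Q)
    (hq : tensorMap (q ≫ s) (q ≫ s) ≫ C.comp ≫ q = C.comp ≫ q) :
    tensorMap (𝟙 _) (q ≫ s) ≫ C.comp ≫ q = C.comp ≫ q := by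
  rw [← hq, ← Category.assoc, ← tensorMap_comp, Category.id_comp, Category.assoc,
    reassoc_of% hs]

theorem tensorMap_id_quotient (hs : s ≫ q = 𝟙 Q)
    (hq : tensorMap (q ≫ s) (q ≫ s) ≫ C.comp ≫ q = C.comp ≫ q) :
    tensorMap (q ≫ s) (𝟙 _) ≫ C.comp ≫ q = C.comp ≫ q := by
  rw [← hq, ← Category.assoc, ← tensorMap_comp, Category.id_comp, Category.assoc,
    reassoc_of% hs]

/-- A quotient of a `T`-multicategory along a split epimorphism of `T`-graphs which is compatible
with composition. -/
noncomputable abbrev quotient (hs : s ≫ q = 𝟙 Q)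
    (hq : tensorMap (q ≫ s) (q ≫ s) ≫ C.comp ≫ q = C.comp ≫ q) : TMulticategory T S where
  graph := Q
  comp := tensorMap s s ≫ C.comp ≫ q
  ids := C.ids ≫ q
  assoc' := by
    have h₁ : tensorMap (𝟙 Q) (tensorMap s s ≫ C.comp ≫ q) ≫ tensorMap s s ≫ C.comp ≫ q =
        tensorMap s (tensorMap s s) ≫ tensorMap (𝟙 _) C.comp ≫ C.comp ≫ q := by
      conv_rhs => rw [← id_tensorMap_quotient hs hq]
      simp only [← Category.assoc, ← tensorMap_comp, Category.id_comp, Category.comp_id]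
    have h₂ : tensorMap (tensorMap s s ≫ C.comp ≫ q) (𝟙 Q) ≫ tensorMap s s ≫ C.comp ≫ q =
        tensorMap (tensorMap s s) s ≫ tensorMap C.comp (𝟙 _) ≫ C.comp ≫ q := by
      conv_rhs => rw [← tensorMap_id_quotient hs hq]
      simp only [← Category.assoc, ← tensorMap_comp, Category.id_comp, Category.comp_id]
    rw [h₁, h₂, reassoc_of% @assoc_naturality, reassoc_of% C.assoc']
  ids_comp := by
    have h : tensorMap (C.ids ≫ q) (𝟙 Q) ≫ tensorMap s s ≫ C.comp ≫ q =
        tensorMap (𝟙 _) s ≫ tensorMap C.ids (𝟙 _) ≫ C.comp ≫ q := by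
      conv_rhs => rw [← tensorMap_id_quotient hs hq]
      simp only [← Category.assoc, ← tensorMap_comp, Category.id_comp, Category.comp_id]
    rw [h, reassoc_of% @leftUnit_naturality, reassoc_of% C.ids_comp, hs]
  comp_ids := by
    have h : tensorMap (𝟙 Q) (C.ids ≫ q) ≫ tensorMap s s ≫ C.comp ≫ q =
        tensorMap s (𝟙 _) ≫ tensorMap (𝟙 _) C.ids ≫ C.comp ≫ q := by
      conv_rhs => rw [← id_tensorMap_quotient hs hq]
      simp only [← Category.assoc, ← tensorMap_comp, Category.id_comp, Category.comp_id]
    rw [h, reassoc_of% @rightUnit_naturality, reassoc_of% C.comp_ids, hs]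

/-- The projection to the quotient of a `T`-multicategory. -/
noncomputable abbrev quotientMap (hs : s ≫ q = 𝟙 Q)
    (hq : tensorMap (q ≫ s) (q ≫ s) ≫ C.comp ≫ q = C.comp ≫ q) : C ⟶ quotient hs hq :=
  Hom.mk (D := quotient hs hq) q (by rw [← hq, tensorMap_comp, Category.assoc]) rfl

/-- The map out of the quotient of a `T`-multicategory induced by a map which is invariant. -/
noncomputable abbrev quotientDesc (hs : s ≫ q = 𝟙 Q)
    (hq : tensorMap (q ≫ s) (q ≫ s) ≫ C.comp ≫ q = C.comp ≫ q) {D : TMulticategory T S}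
    (k : C ⟶ D) (hk : q ≫ s ≫ k.graphHom = k.graphHom) : quotient hs hq ⟶ D :=
  Hom.mk (C := quotient hs hq) (s ≫ k.graphHom)
    (by rw [Category.assoc, Category.assoc, hk, k.map_comp, tensorMap_comp, Category.assoc])
    (by rw [Category.assoc, hk, k.map_ids])

end Quotient

theorem exists_isColimit_of_isSplitPair {C D : TMulticategory T S} (f g : C ⟶ D)
    [(forget T S).IsSplitPair f g] : ∃ c : Cofork f g,
      Nonempty (IsColimit c) ∧ Nonempty (IsColimit ((forget T S).mapCocone c)) := by
  obtain ⟨Q, q, ⟨h⟩⟩ : ∃ (Q : TGraph T S) (q : D.graph ⟶ Q),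
      Nonempty (IsSplitCoequalizer f.graphHom g.graphHom q) :=
    HasSplitCoequalizer.splittable (f := (forget T S).map f) (g := (forget T S).map g)
  let t : D.graph ⟶ C.graph := h.leftSection
  let s : Q ⟶ D.graph := h.rightSection
  have hs : s ≫ q = 𝟙 Q := h.rightSection_π
  have htg : t ≫ g.graphHom = 𝟙 D.graph := h.leftSection_bottom
  have htf : t ≫ f.graphHom = q ≫ s := h.leftSection_top
  have hfg : f.graphHom ≫ q = g.graphHom ≫ q := h.condition
  have hq : tensorMap (q ≫ s) (q ≫ s) ≫ D.comp ≫ q = D.comp ≫ q := by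
    rw [← htf, tensorMap_comp, Category.assoc, ← reassoc_of% f.map_comp, hfg,
      reassoc_of% g.map_comp, ← Category.assoc, ← tensorMap_comp, htg, tensorMap_id,
      Category.id_comp]
  refine ⟨Cofork.ofπ (quotientMap hs hq) (Hom.ext hfg), ⟨Cofork.IsColimit.mk' _ fun c => ?_⟩,
    ⟨(isColimitMapCoconeCoforkEquiv (forget T S) _).symm h.isCoequalizer⟩⟩
  have hc : f.graphHom ≫ c.π.graphHom = g.graphHom ≫ c.π.graphHom :=
    congrArg Hom.graphHom c.condition
  have hk : q ≫ s ≫ c.π.graphHom = c.π.graphHom := by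
    rw [← Category.assoc, ← htf, Category.assoc, hc, reassoc_of% htg]
  refine ⟨quotientDesc hs hq c.π hk, Hom.ext hk, fun {m} hm => Hom.ext ?_⟩
  have hm' : q ≫ m.graphHom = c.π.graphHom := congrArg Hom.graphHom hm
  change m.graphHom = s ≫ c.π.graphHom
  rw [← hm', reassoc_of% hs]

instance : Monad.HasCoequalizerOfIsSplitPair (forget T S) where
  out f g _ := by
    obtain ⟨c, ⟨hc⟩, -⟩ := exists_isColimit_of_isSplitPair f g
    exact ⟨c, hc⟩

instance : Monad.PreservesColimitOfIsSplitPair (forget T S) where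
  out f g _ := by
    obtain ⟨c, ⟨hc⟩, ⟨hc'⟩⟩ := exists_isColimit_of_isSplitPair f g
    exact preservesColimit_of_preserves_colimit_cocone hc hc'

theorem isEquivalence_comparison {F : TGraph T S ⥤ TMulticategory T S} (adj : F ⊣ forget T S) :
    (Monad.comparison adj).IsEquivalence :=
  (Monad.monadicOfHasPreservesGSplitCoequalizersOfReflectsIsomorphisms adj).eqv

end Monadic

end TMulticategory
end Leinster

theorem theorem1p2p2 {E : Type u} [Category.{v} E] [Leinster.SuitableCategory E]
    (T : Monad E) (hT : Leinster.IsSuitableMonad T) (S : E) :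
    ∃ (F : Leinster.TGraph T S ⥤ Leinster.TMulticategory T S)
      (adj : F ⊣ Leinster.TMulticategory.forget T S),
      (Monad.comparison adj).IsEquivalence ∧
      Leinster.SuitableCategory (Leinster.TGraph T S) ∧
      Leinster.IsSuitableMonad adj.toMonad := by
  have : Fact (Leinster.IsSuitableMonad T) := ⟨hT⟩
  exact ⟨Leinster.TMulticategory.free T S, Leinster.TMulticategory.adj T S,
    Leinster.TMulticategory.isEquivalence_comparison _, inferInstance,
    Leinster.TMulticategory.isSuitableMonad_adj⟩
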